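/- **Conventions.** A Lie groupoid $\Sigma\rightrightarrows \mathbf X$ has a Hausdorff second countable base $\mathbf X$ and a smooth, possibly non-Hausdorff and non-second-countable, manifold of arrows; $s$ is a surjective submersion with Hausdorff fibres, and $gh$ is defined when $s(g)=t(h)$. A *Pfaffian groupoid* $(\Sigma,\omega,E)$ over $\mathbf X$ is a Lie groupoid $\Sigma\rightrightarrows\mathbf X$ with a representation $E\to\mathbf X$ and a form $\omega\in\Omega^1(\Sigma,t^*E)$ of constant rank which is multiplicative, $(m^*\omega)_{(g,h)}=(\mathrm{pr}_1^*\omega)_{(g,h)}+g\cdot(\mathrm{pr}_2^*\omega)_{(g,h)}$, and such that $T\Sigma=\ker\omega+\ker ds$, the subbundle $\ker\omega\cap\ker ds$ is involutive, and $\ker\omega\cap\ker dt=\ker\omega\cap\ker ds$. An *isomorphism* $(\Sigma,\omega,E)\cong(\Sigma',\omega',E')$ is an isomorphism $F$ of Lie groupoids together with an isomorphism $\Psi:E\to E'$ of representations over the same diffeomorphism of the bases, such that $F^*\omega'=\Psi\circ\omega$. A *(left) principal $\Sigma$-bundle* over a manifold $M$ (Hausdorff, second countable) is a manifold $P$ with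 a smooth left $\Sigma$-action along a surjective submersion $\mu:P\to\mathbf X$ and a surjective submersion $\pi:P\to M$, such that $\pi$ is invariant and the action is free, transitive on the fibres of $\pi$, and proper (the map $\Sigma\times_{\mathbf X}P\to P\times P$, $(g,p)\mapsto(g\cdot p,p)$, is proper). A *(left) principal $(\Sigma,\omega,E)$-bundle* $(P,\theta)$ is such a bundle with a form $\theta\in\Omega^1(P,\mu^*E)$ such that $(m_P^*\theta)_{(g,p)}=(\mathrm{pr}_1^*\omega)_{(g,p)}+g\cdot(\mathrm{pr}_2^*\theta)_{(g,p)}$ and $\ker d\mu\cap\ker\theta=\ker d\pi\cap\ker\theta$. *Right* principal bundles are defined analogously, with $p\cdot g$ defined when $\mu(p)=t(g)$, and with $(m_P^*\theta)_{(p,g)}=g^{-1}\cdot(\mathrm{pr}_1^*\theta)_{(p,g)}+g^{-1}\cdot(\mathrm{pr}_2^*\omega)_{(p,g)}$. Pfaffian groupoids $(\Sigma_1,\omega_1,E_1)$ over $\mathbf X_1$ and $(\Sigma_2,\omega_2,E_2)$ over $\mathbf X_2$ are *Pfaffian Morita equivalent* if there are a left principal $(\Sigma_1,\omega_1,E_1)$-bundle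 $(P,\theta)$ over $\mathbf X_2$, with moment map $\mu_1$ and projection $\mu_2:P\to\mathbf X_2$, a right action of $\Sigma_2$ on $P$ along $\mu_2$ commuting with that of $\Sigma_1$, and a vector bundle isomorphism $\Phi:\mu_1^*E_1\to\mu_2^*E_2$ over $P$, such that $(P,\Phi\circ\theta)$ is a right principal $(\Sigma_2,\omega_2,E_2)$-bundle over $\mathbf X_1$ with projection $\mu_1$, and $\Phi_{g_1\cdot p}(g_1\cdot\alpha)=\Phi_p(\alpha)$ and $\Phi_{p\cdot g_2}(\alpha)=g_2^{-1}\cdot\Phi_p(\alpha)$ whenever these expressions are defined. Let $(P,\theta)$ be a left principal $(\Sigma,\omega,E)$-bundle over $M$ with moment map $\mu:P\to\mathbf X$ and projection $\pi$. Its *gauge groupoid* $(\mathrm{Gauge}(P),\omega_{\rm gauge},E_{\rm gauge})$ over $M$ has as arrows the quotient manifold $(P\times_{\mathbf X}P)/\Sigma$ of $P\times_{\mathbf X}P=\{(p,p'):\mu(p)=\mu(p')\}$ by the diagonal action (the quotient projection being a surjective submersion), with $t[p,p']=\pi(p)$, $s[p,p']=\pi(p')$ and $[p,p'][p',p'']=[p,p'']$;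 $E_{\rm gauge}$ is the vector bundle $\mu^*E/\Sigma\to M$, the quotient by $g\cdot(p,e)=(g\cdot p,g\cdot e)$, with the representation $[p,p']\cdot[p',e]=[p,e]$; and $\omega_{\rm gauge}$ is the form induced by $\mathrm{pr}_2^*\theta-\mathrm{pr}_1^*\theta$ on $P\times_{\mathbf X}P$, that is, the pullback of $\omega_{\rm gauge}$ to $P\times_{\mathbf X}P$ is, at $(p,p')$, $(v,v')\mapsto[p,\theta(v')-\theta(v)]$. **Theorem.** Let $(\Sigma_1,\omega_1,E_1)$ and $(\Sigma_2,\omega_2,E_2)$ be Pfaffian groupoids over $\mathbf X_1$ and $\mathbf X_2$. They are Pfaffian Morita equivalent if and only if there exist a manifold $M$ and a left principal $(\Sigma_1,\omega_1,E_1)$-bundle $(P,\theta)$ over $M$ such that $(\mathrm{Gauge}(P),(\omega_1)_{\rm gauge},(E_1)_{\rm gauge})$ is a Pfaffian groupoid isomorphic to $(\Sigma_2,\omega_2,E_2)$. -/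

import Mathlib

open Bundle Set
open scoped Manifold ContDiff

universe u

namespace Pfaffian

/-- A smooth manifold of dimension `dim`, without boundary. It may be non-Hausdorff and
non-second-countable; these two properties are required separately where they are needed. -/
structure SmoothManifold : Type (u + 1) where
  carrier : Type u
  dim : ℕ
  [top : TopologicalSpace carrier]
  [charts : ChartedSpace (EuclideanSpace ℝ (Fin dim)) carrier]
  [smooth : IsManifold (𝓡 dim) ∞ carrier]

instance : CoeSort SmoothManifold.{u} (Type u) := ⟨SmoothManifold.carrier⟩

attribute [instance] SmoothManifold.top SmoothManifold.charts SmoothManifold.smooth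

/-- Smooth maps. -/
abbrev SmoothMap (M N : SmoothManifold.{u}) := ContMDiffMap (𝓡 M.dim) (𝓡 N.dim) M N ∞

/-- Diffeomorphisms. -/
abbrev Diffeo (M N : SmoothManifold.{u}) := Diffeomorph (𝓡 M.dim) (𝓡 N.dim) M N ∞

/-- The tangent space of `M` at `p`. -/
abbrev Tan (M : SmoothManifold.{u}) (p : M) := TangentSpace (𝓡 M.dim) p

/-- The differential of a map between manifolds at a point. -/
noncomputable abbrev D {M N : SmoothManifold.{u}} (f : M → N) (p : M) : Tan M p →L[ℝ] Tan N (f p) :=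
  mfderiv (𝓡 M.dim) (𝓡 N.dim) f p

/-- Surjective submersions. -/
def IsSurjSubmersion {M N : SmoothManifold.{u}} (f : M → N) : Prop :=
  Function.Surjective f ∧ Manifold.IsSubmersion (𝓡 M.dim) (𝓡 N.dim) ∞ f

/-- `f : M → N → L` is smooth on the subset `s` of `M × N`. It is used for fibre products `s` of two
submersions, which are embedded submanifolds of `M × N`; there it is smoothness of the
restriction of `f` to the submanifold `s`. -/
def SmoothOn₂ {M N L : SmoothManifold.{u}} (f : M → N → L) (s : Set (M × N)) : Prop :=
  ContMDiffOn ((𝓡 M.dim).prod (𝓡 N.dim)) (𝓡 L.dim) ∞ (fun z : M × N => f z.1 z.2) s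

/-- The differential at `(p, q)`, applied to `(v, w)`, of the restriction of `f : M → N → L` to the
subset `s` of `M × N`. If `s` is an embedded submanifold, then `mfderivWithin` is determined on the
vectors `(v, w)` tangent to `s`, and it is only ever applied to such vectors. -/
noncomputable def D₂ {M N L : SmoothManifold.{u}} (f : M → N → L) (s : Set (M × N)) (p : M) (q : N)
    (v : Tan M p) (w : Tan N q) : Tan L (f p q) :=
  mfderivWithin ((𝓡 M.dim).prod (𝓡 N.dim)) (𝓡 L.dim) (fun z : M × N => f z.1 z.2) s (p, q) (v, w)

/-- A family of tangent subspaces is involutive if it is closed under brackets of the smooth vector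
fields, defined on open subsets, that take values in it. -/
def Involutive {M : SmoothManifold.{u}} (K : ∀ p : M, Submodule ℝ (Tan M p)) : Prop :=
  ∀ (U : Set M), IsOpen U → ∀ V W : (∀ p : M, Tan M p),
    ContMDiffOn (𝓡 M.dim) (𝓡 M.dim).tangent ∞ (fun p => (⟨p, V p⟩ : TangentBundle (𝓡 M.dim) M)) U →
    ContMDiffOn (𝓡 M.dim) (𝓡 M.dim).tangent ∞ (fun p => (⟨p, W p⟩ : TangentBundle (𝓡 M.dim) M)) U →
    (∀ p ∈ U, V p ∈ K p) → (∀ p ∈ U, W p ∈ K p) →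
    ∀ p ∈ U, VectorField.mlieBracket (𝓡 M.dim) V W p ∈ K p

/-! ### Vector bundles and vector-bundle-valued 1-forms -/

/-- A smooth real vector bundle of rank `rank` over `X`. -/
structure VecBundle (X : SmoothManifold.{u}) : Type (u + 1) where
  rank : ℕ
  Fib : X → Type u
  [addCommGroup : ∀ x, AddCommGroup (Fib x)]
  [module : ∀ x, Module ℝ (Fib x)]
  [fibTop : ∀ x, TopologicalSpace (Fib x)]
  [totTop : TopologicalSpace (TotalSpace (EuclideanSpace ℝ (Fin rank)) Fib)]
  [fiberBundle : FiberBundle (EuclideanSpace ℝ (Fin rank)) Fib]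
  [vectorBundle : VectorBundle ℝ (EuclideanSpace ℝ (Fin rank)) Fib]
  [smooth : ContMDiffVectorBundle ∞ (EuclideanSpace ℝ (Fin rank)) Fib (𝓡 X.dim)]

attribute [instance] VecBundle.addCommGroup VecBundle.module VecBundle.fibTop VecBundle.totTop
  VecBundle.fiberBundle VecBundle.vectorBundle VecBundle.smooth

namespace VecBundle

/-- The model fibre. -/
abbrev Model {X : SmoothManifold.{u}} (E : VecBundle X) := EuclideanSpace ℝ (Fin E.rank)

/-- The total space. -/
abbrev Tot {X : SmoothManifold.{u}} (E : VecBundle X) := TotalSpace E.Model E.Fib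

end VecBundle

/-- A family of linear maps `E_{μ p} → F_{ν p}`, `p ∈ P`. To avoid transport along equalities of base
points, source and target fibres are indexed by points `x = μ p` and `y = ν p`. -/
abbrev FibreMaps {P X Y : SmoothManifold.{u}} (μ : P → X) (ν : P → Y) (E : VecBundle X)
    (F : VecBundle Y) :=
  ∀ (p : P) ⦃x : X⦄ ⦃y : Y⦄, μ p = x → ν p = y → (E.Fib x →ₗ[ℝ] F.Fib y)

/-- The same with linear isomorphisms. -/
abbrev FibreEquivs {P X Y : SmoothManifold.{u}} (μ : P → X) (ν : P → Y) (E : VecBundle X)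
    (F : VecBundle Y) :=
  ∀ (p : P) ⦃x : X⦄ ⦃y : Y⦄, μ p = x → ν p = y → (E.Fib x ≃ₗ[ℝ] F.Fib y)

/-- A family of maps `E_{μ p} → F_{ν p}` depends smoothly on `p`: the induced map
`μ^* E → F`, `(p, e) ↦ f_p e`, is smooth. -/
def SmoothFibreMaps {P X Y : SmoothManifold.{u}} (μ : SmoothMap P X) (ν : P → Y) (E : VecBundle X)
    (F : VecBundle Y) (f : ∀ p : P, E.Fib (μ p) → F.Fib (ν p)) : Prop :=
  ContMDiff ((𝓡 P.dim).prod 𝓘(ℝ, E.Model)) ((𝓡 Y.dim).prod 𝓘(ℝ, F.Model)) ∞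
    (fun z : TotalSpace E.Model ((μ : P → X) *ᵖ E.Fib) => (⟨ν z.1, f z.1 z.2⟩ : F.Tot))

/-- A family of linear isomorphisms is an isomorphism of smooth vector bundles
`μ^* E → ν^* F`. -/
def IsBundleIso {P X Y : SmoothManifold.{u}} (μ : SmoothMap P X) (ν : SmoothMap P Y)
    (E : VecBundle X) (F : VecBundle Y) (f : FibreEquivs μ ν E F) : Prop :=
  SmoothFibreMaps μ ν E F (fun p => f p rfl rfl) ∧
    SmoothFibreMaps ν μ F E (fun p => (f p rfl rfl).symm)

/-- (Not necessarily smooth) 1-forms on `P` with values in `μ^* E`: linear maps `T_p P → E_x`, where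
`x = μ p`. -/
abbrev PreForm {P X : SmoothManifold.{u}} (μ : P → X) (E : VecBundle X) :=
  ∀ (p : P) ⦃x : X⦄, μ p = x → (Tan P p →ₗ[ℝ] E.Fib x)

/-- Smoothness of a 1-form `θ` on `P` with values in `μ^* E`: the induced map `T P → E`
is smooth. -/
def SmoothForm {P X : SmoothManifold.{u}} (μ : P → X) (E : VecBundle X) (θ : PreForm μ E) : Prop :=
  ContMDiff (𝓡 P.dim).tangent ((𝓡 X.dim).prod 𝓘(ℝ, E.Model)) ∞
    (fun v : TangentBundle (𝓡 P.dim) P => (⟨μ v.1, θ v.1 rfl v.2⟩ : E.Tot))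

/-! ### Lie groupoids and Pfaffian groupoids -/

/-- A Lie groupoid `Arr ⇉ X`. The product `mul g h` is meaningful when `src g = tgt h`; its other
values are irrelevant. The source map is surjective because of `src_unit`. -/
structure LieGroupoid (X : SmoothManifold.{u}) : Type (u + 1) where
  Arr : SmoothManifold.{u}
  src : SmoothMap Arr X
  tgt : SmoothMap Arr X
  unit : SmoothMap X Arr
  inv : SmoothMap Arr Arr
  mul : Arr → Arr → Arr
  smooth_mul : SmoothOn₂ mul {z | src z.1 = tgt z.2}
  src_mul : ∀ g h, src g = tgt h → src (mul g h) = src h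
  tgt_mul : ∀ g h, src g = tgt h → tgt (mul g h) = tgt g
  mul_assoc : ∀ g h k, src g = tgt h → src h = tgt k → mul (mul g h) k = mul g (mul h k)
  src_unit : ∀ x, src (unit x) = x
  tgt_unit : ∀ x, tgt (unit x) = x
  unit_mul : ∀ g, mul (unit (tgt g)) g = g
  mul_unit : ∀ g, mul g (unit (src g)) = g
  src_inv : ∀ g, src (inv g) = tgt g
  tgt_inv : ∀ g, tgt (inv g) = src g
  inv_mul : ∀ g, mul (inv g) g = unit (src g)
  mul_inv : ∀ g, mul g (inv g) = unit (tgt g)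
  submersion_src : IsSurjSubmersion src
  t2_fibres : ∀ x, T2Space {g : Arr // src g = x}
  t2_base : T2Space X
  secondCountable_base : SecondCountableTopology X

/-- The set of composable pairs of arrows. -/
def LieGroupoid.Composable {X : SmoothManifold.{u}} (S : LieGroupoid X) : Set (S.Arr × S.Arr) :=
  {z | S.src z.1 = S.tgt z.2}

/-- A Pfaffian groupoid `(Σ, ω, E)` over `X`. The representation is `g ↦ rep g : E_x → E_y`
for an arrow `g : x → y`. -/
structure PfaffianGroupoid (X : SmoothManifold.{u}) : Type (u + 1) extends LieGroupoid X where
  E : VecBundle X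
  rep : FibreMaps src tgt E E
  rep_unit : ∀ (x : X) (e : E.Fib x), rep (unit x) (src_unit x) (tgt_unit x) e = e
  rep_mul : ∀ (g h : Arr) (hgh : src g = tgt h) ⦃x y : X⦄ (hx : src h = x) (hy : tgt g = y)
    (e : E.Fib x), rep (mul g h) ((src_mul g h hgh).trans hx) ((tgt_mul g h hgh).trans hy) e =
      rep g rfl hy (rep h hx hgh.symm e)
  smooth_rep : SmoothFibreMaps src tgt E E (fun g => rep g rfl rfl)
  form : PreForm tgt E
  smooth_form : SmoothForm tgt E form
  /-- `m^* ω = pr₁^* ω + g · pr₂^* ω` on the manifold of composable pairs `(g, h)`. -/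
  multiplicative : ∀ (g h : Arr) (hgh : src g = tgt h) (v : Tan Arr g) (w : Tan Arr h),
    D src g v = D tgt h w →
    form (mul g h) (tgt_mul g h hgh) (D₂ mul toLieGroupoid.Composable g h v w) =
      form g rfl v + rep g hgh rfl (form h rfl w)
  constant_rank : ∃ r : ℕ, ∀ g : Arr, Module.finrank ℝ (LinearMap.range (form g rfl)) = r
  transversal : ∀ g : Arr, LinearMap.ker (form g rfl) ⊔ (D src g).ker = ⊤
  involutive : Involutive (fun g : Arr => LinearMap.ker (form g rfl) ⊓ (D src g).ker)
  ker_eq : ∀ g : Arr, LinearMap.ker (form g rfl) ⊓ (D tgt g).ker =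
    LinearMap.ker (form g rfl) ⊓ (D src g).ker

/-- An isomorphism of Pfaffian groupoids `(Σ₁, ω₁, E₁) ≅ (Σ₂, ω₂, E₂)`: an isomorphism
`Φ` of Lie groupoids and an isomorphism `Ψ` of representations, both covering `φ`, with
`Φ^* ω₂ = Ψ ∘ ω₁`. -/
structure PfaffianIso {X₁ X₂ : SmoothManifold.{u}} (S₁ : PfaffianGroupoid X₁)
    (S₂ : PfaffianGroupoid X₂) where
  φ : Diffeo X₁ X₂
  Φ : Diffeo S₁.Arr S₂.Arr
  src_Φ : ∀ g, S₂.src (Φ g) = φ (S₁.src g)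
  tgt_Φ : ∀ g, S₂.tgt (Φ g) = φ (S₁.tgt g)
  Φ_mul : ∀ g h, S₁.src g = S₁.tgt h → Φ (S₁.mul g h) = S₂.mul (Φ g) (Φ h)
  Ψ : ∀ ⦃x : X₁⦄ ⦃y : X₂⦄, φ x = y → (S₁.E.Fib x ≃ₗ[ℝ] S₂.E.Fib y)
  smooth_Ψ : ContMDiff ((𝓡 X₁.dim).prod 𝓘(ℝ, S₁.E.Model)) ((𝓡 X₂.dim).prod 𝓘(ℝ, S₂.E.Model)) ∞
    (fun z : S₁.E.Tot => (⟨φ z.1, Ψ rfl z.2⟩ : S₂.E.Tot))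
  smooth_Ψ_symm :
    ContMDiff ((𝓡 X₂.dim).prod 𝓘(ℝ, S₂.E.Model)) ((𝓡 X₁.dim).prod 𝓘(ℝ, S₁.E.Model)) ∞
    (fun z : S₂.E.Tot => (⟨φ.symm z.1, (Ψ (φ.apply_symm_apply z.1)).symm z.2⟩ : S₁.E.Tot))
  Ψ_rep : ∀ (g : S₁.Arr) (e : S₁.E.Fib (S₁.src g)),
    Ψ rfl (S₁.rep g rfl rfl e) = S₂.rep (Φ g) (src_Φ g) (tgt_Φ g) (Ψ rfl e)
  pullback_form : ∀ (g : S₁.Arr) (v : Tan S₁.Arr g),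
    S₂.form (Φ g) (tgt_Φ g) (D Φ g v) = Ψ rfl (S₁.form g rfl v)

/-! ### Principal bundles -/

/-- The left action `act` (meaningful on pairs `(g, p)` with `src g = μ p`) of `S` along the moment
map `μ` makes `proj : P → M` into a left principal `S`-bundle over `M`. The moment map is
a surjective submersion. -/
structure IsLeftPrincipal {X P M : SmoothManifold.{u}} (S : LieGroupoid X) (μ : SmoothMap P X)
    (proj : SmoothMap P M) (act : S.Arr → P → P) : Prop where
  smooth_act : SmoothOn₂ act {z | S.src z.1 = μ z.2}
  μ_act : ∀ g p, S.src g = μ p → μ (act g p) = S.tgt g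
  mul_act : ∀ g h p, S.src g = S.tgt h → S.src h = μ p → act (S.mul g h) p = act g (act h p)
  unit_act : ∀ p, act (S.unit (μ p)) p = p
  submersion_μ : IsSurjSubmersion μ
  submersion_proj : IsSurjSubmersion proj
  proj_act : ∀ g p, S.src g = μ p → proj (act g p) = proj p
  transitive : ∀ p p', proj p = proj p' → ∃ g, S.src g = μ p ∧ act g p = p'
  free : ∀ g p, S.src g = μ p → act g p = p → g = S.unit (μ p)
  proper : IsProperMap
    (fun z : {z : S.Arr × P // S.src z.1 = μ z.2} => (act z.1.1 z.1.2, z.1.2))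
  t2_base : T2Space M
  secondCountable_base : SecondCountableTopology M

/-- The right action `act` (meaningful on pairs `(p, g)` with `μ p = tgt g`) of `S` along the moment
map `μ` makes `proj : P → M` into a right principal `S`-bundle over `M`. -/
structure IsRightPrincipal {X P M : SmoothManifold.{u}} (S : LieGroupoid X) (μ : SmoothMap P X)
    (proj : SmoothMap P M) (act : P → S.Arr → P) : Prop where
  smooth_act : SmoothOn₂ act {z | μ z.1 = S.tgt z.2}
  μ_act : ∀ p g, μ p = S.tgt g → μ (act p g) = S.src g
  act_mul : ∀ p g h, μ p = S.tgt g → S.src g = S.tgt h → act p (S.mul g h) = act (act p g) h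
  act_unit : ∀ p, act p (S.unit (μ p)) = p
  submersion_μ : IsSurjSubmersion μ
  submersion_proj : IsSurjSubmersion proj
  proj_act : ∀ p g, μ p = S.tgt g → proj (act p g) = proj p
  transitive : ∀ p p', proj p = proj p' → ∃ g, μ p = S.tgt g ∧ act p g = p'
  free : ∀ p g, μ p = S.tgt g → act p g = p → g = S.unit (μ p)
  proper : IsProperMap
    (fun z : {z : P × S.Arr // μ z.1 = S.tgt z.2} => (z.1.1, act z.1.1 z.1.2))
  t2_base : T2Space M
  secondCountable_base : SecondCountableTopology M

/-- `proj : P → M` with the form `θ ∈ Ω¹(P, μ^* E)` is a left principal `(Σ, ω, E)`-bundle. -/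
structure IsLeftPfaffian {X P M : SmoothManifold.{u}} (S : PfaffianGroupoid X) (μ : SmoothMap P X)
    (proj : SmoothMap P M) (act : S.Arr → P → P) (θ : PreForm μ S.E) : Prop where
  principal : IsLeftPrincipal S.toLieGroupoid μ proj act
  smooth_θ : SmoothForm μ S.E θ
  /-- `m_P^* θ = pr₁^* ω + g · pr₂^* θ`. -/
  multiplicative : ∀ (g : S.Arr) (p : P) (h : S.src g = μ p) (v : Tan S.Arr g) (w : Tan P p),
    D S.src g v = D μ p w →
    θ (act g p) (principal.μ_act g p h) (D₂ act {z | S.src z.1 = μ z.2} g p v w) =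
      S.form g rfl v + S.rep g h rfl (θ p rfl w)
  ker_eq : ∀ p : P, (D μ p).ker ⊓ LinearMap.ker (θ p rfl) =
    (D proj p).ker ⊓ LinearMap.ker (θ p rfl)

/-- `proj : P → M` with the form `θ ∈ Ω¹(P, μ^* E)` is a right principal `(Σ, ω, E)`-bundle. -/
structure IsRightPfaffian {X P M : SmoothManifold.{u}} (S : PfaffianGroupoid X) (μ : SmoothMap P X)
    (proj : SmoothMap P M) (act : P → S.Arr → P) (θ : PreForm μ S.E) : Prop where
  principal : IsRightPrincipal S.toLieGroupoid μ proj act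
  smooth_θ : SmoothForm μ S.E θ
  /-- `m_P^* θ = g⁻¹ · pr₁^* θ + g⁻¹ · pr₂^* ω`. -/
  multiplicative : ∀ (p : P) (g : S.Arr) (h : μ p = S.tgt g) (v : Tan P p) (w : Tan S.Arr g),
    D μ p v = D S.tgt g w →
    θ (act p g) (principal.μ_act p g h) (D₂ act {z | μ z.1 = S.tgt z.2} p g v w) =
      S.rep (S.inv g) (S.src_inv g) (S.tgt_inv g) (θ p h v) +
        S.rep (S.inv g) (S.src_inv g) (S.tgt_inv g) (S.form g rfl w)
  ker_eq : ∀ p : P, (D μ p).ker ⊓ LinearMap.ker (θ p rfl) =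
    (D proj p).ker ⊓ LinearMap.ker (θ p rfl)

/-- A (left) principal `(Σ, ω, E)`-bundle `(P, θ)` over `M`. -/
structure PrincipalPfaffianBundle {X : SmoothManifold.{u}} (S : PfaffianGroupoid X)
    (M : SmoothManifold.{u}) : Type (u + 1) where
  P : SmoothManifold.{u}
  μ : SmoothMap P X
  proj : SmoothMap P M
  act : S.Arr → P → P
  θ : PreForm μ S.E
  isPfaffian : IsLeftPfaffian S μ proj act θ

/-! ### Pfaffian Morita equivalence -/

/-- A principal Pfaffian bibundle `(P, θ, Φ)` between `(Σ₁, ω₁, E₁)` and `(Σ₂, ω₂, E₂)`. -/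
structure PrincipalPfaffianBibundle {X₁ X₂ : SmoothManifold.{u}} (S₁ : PfaffianGroupoid X₁)
    (S₂ : PfaffianGroupoid X₂) : Type (u + 1) where
  P : SmoothManifold.{u}
  μ₁ : SmoothMap P X₁
  μ₂ : SmoothMap P X₂
  act₁ : S₁.Arr → P → P
  act₂ : P → S₂.Arr → P
  θ : PreForm μ₁ S₁.E
  Φ : FibreEquivs μ₁ μ₂ S₁.E S₂.E
  isBundleIso : IsBundleIso μ₁ μ₂ S₁.E S₂.E Φ
  left : IsLeftPfaffian S₁ μ₁ μ₂ act₁ θ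
  right : IsRightPfaffian S₂ μ₂ μ₁ act₂
    (fun p _ hy => (Φ p rfl hy).toLinearMap ∘ₗ θ p rfl)
  commute : ∀ g p h, S₁.src g = μ₁ p → μ₂ p = S₂.tgt h →
    act₂ (act₁ g p) h = act₁ g (act₂ p h)
  /-- `Φ_{g₁ p} (g₁ · α) = Φ_p α`. -/
  Φ_left : ∀ (g : S₁.Arr) (p : P) (h : S₁.src g = μ₁ p) (α : S₁.E.Fib (μ₁ p)),
    Φ (act₁ g p) (left.principal.μ_act g p h) (left.principal.proj_act g p h)
      (S₁.rep g h rfl α) = Φ p rfl rfl α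
  /-- `Φ_{p g₂} α = g₂⁻¹ · Φ_p α`. -/
  Φ_right : ∀ (p : P) (g : S₂.Arr) (h : μ₂ p = S₂.tgt g) (α : S₁.E.Fib (μ₁ p)),
    Φ (act₂ p g) (right.principal.proj_act p g h) (right.principal.μ_act p g h) α =
      S₂.rep (S₂.inv g) (S₂.src_inv g) (S₂.tgt_inv g) (Φ p rfl h α)

/-- Pfaffian Morita equivalence. -/
def PfaffianMoritaEquivalent {X₁ X₂ : SmoothManifold.{u}} (S₁ : PfaffianGroupoid X₁)
    (S₂ : PfaffianGroupoid X₂) : Prop :=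
  Nonempty (PrincipalPfaffianBibundle S₁ S₂)

/-! ### The gauge groupoid -/

/-- The fibre product `P ×_X P` along the moment map. -/
def PrincipalPfaffianBundle.FibreSquare {X M : SmoothManifold.{u}} {S : PfaffianGroupoid X}
    (B : PrincipalPfaffianBundle S M) : Set (B.P × B.P) :=
  {z | B.μ z.1 = B.μ z.2}

/-- `G` is the Pfaffian gauge groupoid `(Gauge(P), ω_gauge, E_gauge)` of the principal
`(Σ, ω, E)`-bundle `(P, θ)` over `M`.

* The manifold of arrows of `G` is the quotient manifold of `P ×_X P` by the diagonal action of `Σ`: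
  the projection `q`, `(p, p') ↦ [p, p']`, is a surjective submersion whose fibres are the orbits.
* The arrow `[p, p']` goes from `proj p'` to `proj p`, and `[p, p'] · [p', p''] = [p, p'']`. (This
  determines the units `[p, p]` and the inverses `[p', p]`.)
* The vector bundle `E_gauge` is the quotient bundle of `μ^* E` by the action
  `g · (p, e) = (g p, g e)`: the projection `μ^* E → E_gauge`, `(p, e) ↦ [p, e] = j_p e` over `proj` is
  invariant and identifies `μ^* E` with `proj^* E_gauge`.
* The representation is `[p, p'] · [p', e] = [p, e]`.
* The form `ω_gauge` is the form to which `pr₂^* θ - pr₁^* θ` on `P ×_X P` descends.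

These conditions determine `G` up to isomorphism. -/
structure PfaffianGauge {X M : SmoothManifold.{u}} {S : PfaffianGroupoid X}
    (B : PrincipalPfaffianBundle S M) (G : PfaffianGroupoid M) where
  q : B.P → B.P → G.Arr
  smooth_q : SmoothOn₂ q B.FibreSquare
  submersion_q : ∀ p p', B.μ p = B.μ p' → ∀ u : Tan G.Arr (q p p'),
    ∃ (v : Tan B.P p) (w : Tan B.P p'), D B.μ p v = D B.μ p' w ∧ D₂ q B.FibreSquare p p' v w = u
  surjective_q : ∀ a : G.Arr, ∃ p p', B.μ p = B.μ p' ∧ q p p' = a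
  q_eq_iff : ∀ p p' r r', B.μ p = B.μ p' → B.μ r = B.μ r' →
    (q p p' = q r r' ↔ ∃ g, S.src g = B.μ p ∧ B.act g p = r ∧ B.act g p' = r')
  src_q : ∀ p p', B.μ p = B.μ p' → G.src (q p p') = B.proj p'
  tgt_q : ∀ p p', B.μ p = B.μ p' → G.tgt (q p p') = B.proj p
  mul_q : ∀ p p' p'', B.μ p = B.μ p' → B.μ p' = B.μ p'' →
    G.mul (q p p') (q p' p'') = q p p''
  j : FibreEquivs B.μ B.proj S.E G.E
  isBundleIso_j : IsBundleIso B.μ B.proj S.E G.E j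
  j_act : ∀ (g : S.Arr) (p : B.P) (h : S.src g = B.μ p) (e : S.E.Fib (B.μ p)),
    j (B.act g p) (B.isPfaffian.principal.μ_act g p h) (B.isPfaffian.principal.proj_act g p h)
      (S.rep g h rfl e) = j p rfl rfl e
  rep_q : ∀ (p p' : B.P) (h : B.μ p = B.μ p') (e : S.E.Fib (B.μ p')),
    G.rep (q p p') (src_q p p' h) (tgt_q p p' h) (j p' rfl rfl e) = j p h rfl e
  form_q : ∀ (p p' : B.P) (h : B.μ p = B.μ p') (v : Tan B.P p) (w : Tan B.P p'),
    D B.μ p v = D B.μ p' w →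
    G.form (q p p') (tgt_q p p' h) (D₂ q B.FibreSquare p p' v w) =
      j p h rfl (B.θ p' rfl w - B.θ p h v)

end Pfaffian

/-!
If `R` is a bibundle between `S₁` and `S₂`, then `S₂` itself is a gauge groupoid of the left
principal bundle underlying `R`: the class of a pair `(p, p')` in a fibre of `μ₁` is the unique
arrow `division p p'` of `S₂` with `p · division p p' = p'`. Conversely, the gauge groupoid of a
principal bundle acts on it from the right by `p · [p, p'] = p'`, which gives a bibundle between
the structure groupoid and the gauge groupoid; an isomorphism transports it to any isomorphic
groupoid.

The point that needs work is that the division map is smooth, both for `division` to be a quotient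
map and for the action of the gauge groupoid to be smooth. Consider the shear map
`(p, g) ↦ (p, p · g)` on the fibre product of `P` and the arrows. A free action is infinitesimally
free: if the fundamental vector field of an element `α` of the Lie algebroid vanishes at `p`, then
`p` is fixed along the integral curve of the left invariant vector field of `α`, which is therefore
constant. Hence the shear map is an immersion and has smooth local left inverses; since it is
injective and proper it is also a closed embedding, so these invert it in a neighbourhood within the
image.

Derivatives along fibre products are computed on curves: every tangent vector to the fibre product
of a submersion with a smooth map is the velocity of a curve in the fibre product.
-/

namespace Pfaffian

open Filter Topology

section Analysis

variable {E F : Type*} [NormedAddCommGroup E] [NormedSpace ℝ E] [NormedAddCommGroup F]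
  [NormedSpace ℝ F]

theorem exists_comp_eq_of_ker_le {K V W U : Type*} [Field K] [AddCommGroup V] [Module K V]
    [AddCommGroup W] [Module K W] [AddCommGroup U] [Module K U] {A : V →ₗ[K] W} {R : V →ₗ[K] U}
    (h : LinearMap.ker A ≤ LinearMap.ker R) : ∃ L : W →ₗ[K] U, L ∘ₗ A = R := by
  obtain ⟨L, hL⟩ := LinearMap.exists_extend
    ((LinearMap.ker A).liftQ R h ∘ₗ A.quotKerEquivRange.symm.toLinearMap)
  refine ⟨L, LinearMap.ext fun v => ?_⟩
  simpa [LinearMap.quotKerEquivRange_apply_mk] using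
    LinearMap.congr_fun hL (A.quotKerEquivRange (Submodule.Quotient.mk v))

theorem exists_contDiffAt_localInverse [CompleteSpace E] {f : E → E} {z : E}
    (hf : ContDiffAt ℝ ∞ f z) (hf' : HasFDerivAt f (ContinuousLinearMap.id ℝ E) z) :
    ∃ g : E → E, ContDiffAt ℝ ∞ g (f z) ∧ g (f z) = z ∧ (∀ᶠ y in 𝓝 z, g (f y) = y) ∧
      ∀ᶠ y in 𝓝 (f z), f (g y) = y := by
  have hf'' : HasFDerivAt f ((ContinuousLinearEquiv.refl ℝ E : E ≃L[ℝ] E) : E →L[ℝ] E) z := hf'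
  have hn : (∞ : WithTop ℕ∞) ≠ 0 := by simp
  have hs := hf.hasStrictFDerivAt' hf'' hn
  exact ⟨hf.localInverse hf'' hn, hf.to_localInverse hf'' hn, hs.localInverse_apply_image,
    hs.eventually_left_inverse, hs.eventually_right_inverse⟩

/- If `L` satisfies `L ∘ Df = Dr`, the map `L ∘ f + (1 - r)` has derivative `1` at `z` and agrees
with `L ∘ f` on the fixed points of `r`. -/
theorem exists_contDiffAt_leftInverse_on_fixedPoints [CompleteSpace E] [FiniteDimensional ℝ F]
    {r : E → E} {f : E → F} {z : E} (hr : ContDiffAt ℝ ∞ r z) (hf : ContDiffAt ℝ ∞ f z)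
    (hrz : r z = z) (hker : ∀ v, fderiv ℝ f z v = 0 → fderiv ℝ r z v = 0) :
    ∃ k : F → E, ContDiffAt ℝ ∞ k (f z) ∧ k (f z) = z ∧ ∀ᶠ y in 𝓝 z, r y = y → k (f y) = y := by
  obtain ⟨L₀, hL₀⟩ := exists_comp_eq_of_ker_le (A := (fderiv ℝ f z : E →ₗ[ℝ] F))
    (R := (fderiv ℝ r z : E →ₗ[ℝ] E)) hker
  let L : F →L[ℝ] E := LinearMap.toContinuousLinearMap L₀
  have hn : (∞ : WithTop ℕ∞) ≠ 0 := by simp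
  have hLf : L.comp (fderiv ℝ f z) = fderiv ℝ r z :=
    ContinuousLinearMap.ext fun v => LinearMap.congr_fun hL₀ v
  have hderiv : HasFDerivAt (fun y => L (f y) + (y - r y)) (ContinuousLinearMap.id ℝ E) z := by
    have h := (L.hasFDerivAt.comp z (hf.differentiableAt hn).hasFDerivAt).add
      ((hasFDerivAt_id z).sub (hr.differentiableAt hn).hasFDerivAt)
    rwa [hLf, add_sub_cancel] at h
  obtain ⟨g, hg, hgz, hgleft, -⟩ := exists_contDiffAt_localInverse
    ((L.contDiff.contDiffAt.comp z hf).add (contDiffAt_id.sub hr)) hderiv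
  have hLz : L (f z) + (z - r z) = L (f z) := by rw [hrz, sub_self, add_zero]
  simp only [Function.comp_apply, id_eq, hLz] at hg hgz
  refine ⟨fun y => g (L y), hg.comp (f z) L.contDiff.contDiffAt, hgz, ?_⟩
  filter_upwards [hgleft] with y hy hry
  simpa [hry] using hy

theorem exists_contDiffAt_localSection [CompleteSpace F] [FiniteDimensional ℝ F]
    {f : E → F} {z : E} (hf : ContDiffAt ℝ ∞ f z) (hsurj : Function.Surjective (fderiv ℝ f z)) :
    ∃ k : F → E, ContDiffAt ℝ ∞ k (f z) ∧ k (f z) = z ∧ ∀ᶠ y in 𝓝 (f z), f (k y) = y := by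
  obtain ⟨L₀, hL₀⟩ := LinearMap.exists_rightInverse_of_surjective
    (fderiv ℝ f z : E →ₗ[ℝ] F) (LinearMap.range_eq_top.2 hsurj)
  let L : F →L[ℝ] E := LinearMap.toContinuousLinearMap L₀
  have hn : (∞ : WithTop ℕ∞) ≠ 0 := by simp
  let a : F → E := fun y => z + L (y - f z)
  have ha : ContDiff ℝ ∞ a := contDiff_const.add (L.contDiff.comp (contDiff_id.sub contDiff_const))
  have haz : a (f z) = z := by simp [a]
  have haderiv : HasFDerivAt a L (f z) := by
    have h := (L.hasFDerivAt.comp (f z) ((hasFDerivAt_id (f z)).sub_const (f z))).const_add z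
    rwa [ContinuousLinearMap.comp_id] at h
  have hderiv : HasFDerivAt (f ∘ a) (ContinuousLinearMap.id ℝ F) (f z) := by
    have h : HasFDerivAt f (fderiv ℝ f z) (a (f z)) := by
      rw [haz]
      exact (hf.differentiableAt hn).hasFDerivAt
    convert h.comp (f z) haderiv using 1
    exact ContinuousLinearMap.ext fun v => (LinearMap.congr_fun hL₀ v).symm
  obtain ⟨g, hg, hgz, -, hgright⟩ := exists_contDiffAt_localInverse
    (ContDiffAt.comp (f z) (by rwa [haz]) ha.contDiffAt) hderiv
  simp only [Function.comp_apply, haz] at hg hgz hgright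
  exact ⟨a ∘ g, ha.contDiffAt.comp _ hg, by simp [hgz, haz], hgright⟩

end Analysis

section Velocity

variable {E E' H H' M M' : Type*}
  [NormedAddCommGroup E] [NormedSpace ℝ E] [TopologicalSpace H] {I : ModelWithCorners ℝ E H}
  [TopologicalSpace M] [ChartedSpace H M]
  [NormedAddCommGroup E'] [NormedSpace ℝ E'] [TopologicalSpace H'] {I' : ModelWithCorners ℝ E' H'}
  [TopologicalSpace M'] [ChartedSpace H' M']

variable (I) in
/-- The curve `γ` passes through `x` at time `t` with velocity `v`. The point `x` is kept apart from
`γ t`, so that the velocity need not be transported along an equality of points. -/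
def HasVelocityAt (γ : ℝ → M) (t : ℝ) (x : M) (v : TangentSpace I x) : Prop :=
  γ t = x ∧ HasMFDerivAt 𝓘(ℝ, ℝ) I γ t ((1 : ℝ →L[ℝ] ℝ).smulRight (v : E))

namespace HasVelocityAt

variable {γ γ' : ℝ → M} {t : ℝ} {x : M} {v w : TangentSpace I x}

theorem tendsto (h : HasVelocityAt I γ t x v) : Tendsto γ (𝓝 t) (𝓝 x) :=
  h.1 ▸ h.2.continuousAt

theorem unique (h : HasVelocityAt I γ t x v) (h' : HasVelocityAt I γ t x w) : v = w := by
  have e := DFunLike.congr_fun (hasMFDerivAt_unique h.2 h'.2) (1 : ℝ)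
  exact (one_smul ℝ (v : E)).symm.trans (e.trans (one_smul ℝ (w : E)))

theorem congr_point (h : HasVelocityAt I γ t x v) {y : M} (e : x = y) :
    HasVelocityAt I γ t y (v : E) :=
  ⟨h.1.trans e, h.2⟩

theorem congr_of_eventuallyEq (h : HasVelocityAt I γ t x v) (hγ : γ' =ᶠ[𝓝 t] γ) :
    HasVelocityAt I γ' t x v :=
  ⟨hγ.eq_of_nhds.trans h.1, h.2.congr_of_eventuallyEq hγ⟩

theorem const (x : M) (t : ℝ) : HasVelocityAt I (fun _ => x) t x 0 := by
  refine ⟨rfl, (hasMFDerivAt_const x t).congr_mfderiv (ContinuousLinearMap.ext fun τ : ℝ => ?_)⟩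
  exact (smul_zero (A := E) τ).symm

theorem comp_mfderivWithin (h : HasVelocityAt I γ t x v) {f : M → M'} {s : Set M}
    (hf : MDifferentiableWithinAt I I' f s x) (hs : ∀ᶠ τ in 𝓝 t, γ τ ∈ s) :
    HasVelocityAt I' (f ∘ γ) t (f x) (mfderivWithin I I' f s x v) := by
  obtain ⟨rfl, h⟩ := h
  refine ⟨rfl, ?_⟩
  have hcomp := hf.hasMFDerivWithinAt.comp t (h.hasMFDerivWithinAt (s := γ ⁻¹' s)) subset_rfl
  have e : (mfderivWithin I I' f s (γ t)).comp ((1 : ℝ →L[ℝ] ℝ).smulRight (v : E)) =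
      (1 : ℝ →L[ℝ] ℝ).smulRight (mfderivWithin I I' f s (γ t) v : E') := by
    refine ContinuousLinearMap.ext fun τ => ?_
    exact map_smul (mfderivWithin I I' f s (γ t)) τ v
  exact e ▸ hcomp.hasMFDerivAt hs

theorem comp_mfderiv (h : HasVelocityAt I γ t x v) {f : M → M'} (hf : MDifferentiableAt I I' f x) :
    HasVelocityAt I' (f ∘ γ) t (f x) (mfderiv I I' f x v) := by
  rw [← mfderivWithin_univ]
  exact h.comp_mfderivWithin hf.mdifferentiableWithinAt (by simp)

theorem comp (h : HasVelocityAt I γ t x v) {f : M → M'} (hf : ContMDiffAt I I' ∞ f x) :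
    HasVelocityAt I' (f ∘ γ) t (f x) (mfderiv I I' f x v) :=
  h.comp_mfderiv (hf.mdifferentiableAt (by simp))

theorem prodMk (h : HasVelocityAt I γ t x v) {δ : ℝ → M'} {y : M'} {u : TangentSpace I' y}
    (h' : HasVelocityAt I' δ t y u) :
    HasVelocityAt (I.prod I') (fun τ => (γ τ, δ τ)) t (x, y) ((v, u) : E × E') :=
  ⟨Prod.ext h.1 h'.1,
    (h.2.prodMk h'.2).congr_mfderiv (ContinuousLinearMap.ext fun _ => rfl)⟩

theorem fst {γ : ℝ → M × M'} {z : M × M'} {v : TangentSpace (I.prod I') z}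
    (h : HasVelocityAt (I.prod I') γ t z v) :
    HasVelocityAt I (fun τ => (γ τ).1) t z.1 (v : E × E').1 := by
  have h' := h.comp_mfderiv (f := Prod.fst) mdifferentiableAt_fst
  rwa [mfderiv_fst] at h'

theorem snd {γ : ℝ → M × M'} {z : M × M'} {v : TangentSpace (I.prod I') z}
    (h : HasVelocityAt (I.prod I') γ t z v) :
    HasVelocityAt I' (fun τ => (γ τ).2) t z.2 (v : E × E').2 := by
  have h' := h.comp_mfderiv (f := Prod.snd) mdifferentiableAt_snd
  rwa [mfderiv_snd] at h'

end HasVelocityAt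

theorem hasVelocityAt_iff_extChartAt {γ : ℝ → M} {t : ℝ} {x : M} {v : TangentSpace I x} :
    HasVelocityAt I γ t x v ↔
      γ t = x ∧ ContinuousAt γ t ∧ HasDerivAt (F := E) (extChartAt I x ∘ γ) v t := by
  refine and_congr_right fun hx => and_congr_right fun _ => ?_
  subst hx
  rw [(𝓘(ℝ, ℝ)).range_eq_univ]
  exact hasFDerivWithinAt_univ (𝕜 := ℝ) (E := ℝ) (F := E)

/-- The variation `(y, τ) ↦ φ⁻¹ (φ (f y) + τ v)`, where `φ` is the chart at `f x`. -/
theorem exists_contMDiffAt_variation [I'.Boundaryless] [IsManifold I' ∞ M'] {f : M → M'} {x : M}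
    (hf : ContMDiffAt I I' ∞ f x) (v : TangentSpace I' (f x)) :
    ∃ c : M → ℝ → M', ContMDiffAt (I.prod 𝓘(ℝ, ℝ)) I' ∞ (Function.uncurry c) (x, 0) ∧
      (∀ᶠ y in 𝓝 x, c y 0 = f y) ∧ HasVelocityAt I' (c x) 0 (f x) v := by
  let φ := extChartAt I' (f x)
  let u : E' := v
  have hφt : φ.target ∈ 𝓝 (φ (f x)) := extChartAt_target_mem_nhds (f x)
  have hline : HasDerivAt (fun τ : ℝ => φ (f x) + τ • u) u 0 := by
    simpa using ((hasDerivAt_id (0 : ℝ)).smul_const u).const_add (φ (f x))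
  have hline₀ : φ (f x) + (0 : ℝ) • u = φ (f x) := by rw [zero_smul, add_zero]
  have hsymm : ContMDiffAt 𝓘(ℝ, E') I' ∞ φ.symm (φ (f x) + (0 : ℝ) • u) := by
    rw [hline₀]
    exact (contMDiffOn_extChartAt_symm (f x)).contMDiffAt hφt
  refine ⟨fun y τ => φ.symm (φ (f y) + τ • u), ?_, ?_, ?_⟩
  · have hφ : ContMDiffAt (I.prod 𝓘(ℝ, ℝ)) 𝓘(ℝ, E') ∞ (fun z : M × ℝ => φ (f z.1)) (x, 0) :=
      ContMDiffAt.comp (x, (0 : ℝ)) (g := φ ∘ f) (contMDiffAt_extChartAt.comp x hf)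
        contMDiffAt_fst
    exact ContMDiffAt.comp (x, (0 : ℝ)) (g := φ.symm) hsymm
      (hφ.add (contMDiffAt_snd.smul contMDiffAt_const))
  · filter_upwards [hf.continuousAt.eventually (extChartAt_source_mem_nhds (I := I') (f x))]
      with y hy
    rw [zero_smul, add_zero, φ.left_inv hy]
  · refine hasVelocityAt_iff_extChartAt.2
      ⟨(congrArg φ.symm hline₀).trans (extChartAt_to_inv (f x)),
        ContinuousAt.comp (f := fun τ : ℝ => φ (f x) + τ • u) hsymm.continuousAt
          hline.continuousAt, ?_⟩
    refine HasDerivAt.congr_of_eventuallyEq (F := E') hline ?_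
    filter_upwards [hline.continuousAt.eventually (hline₀.symm ▸ hφt)] with τ hτ
    exact φ.right_inv hτ

theorem exists_hasVelocityAt [I.Boundaryless] [IsManifold I ∞ M] (x : M) (v : TangentSpace I x) :
    ∃ γ, HasVelocityAt I γ 0 x v := by
  obtain ⟨c, -, -, hc⟩ := exists_contMDiffAt_variation (contMDiffAt_id (I := I) (x := x)) v
  exact ⟨c x, hc⟩

theorem exists_contMDiffAt_leftInverse_on_fixedPoints [I.Boundaryless] [IsManifold I ∞ M]
    [CompleteSpace E] [FiniteDimensional ℝ E']
    {r : M → M} {f : M → M'} {z : M} (hr : ContMDiffAt I I ∞ r z) (hf : ContMDiffAt I I' ∞ f z)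
    (hrz : r z = z) (hker : ∀ v, mfderiv I I' f z v = 0 → mfderiv I I r z v = 0) :
    ∃ k : M' → M, ContMDiffAt I' I ∞ k (f z) ∧ ∀ᶠ y in 𝓝 z, r y = y → k (f y) = y := by
  have hr' := (contMDiffAt_iff.1 hr).2
  have hf' := (contMDiffAt_iff.1 hf).2
  rw [(hr.mdifferentiableAt (by simp)).mfderiv, (hf.mdifferentiableAt (by simp)).mfderiv] at hker
  simp only [I.range_eq_univ, contDiffWithinAt_univ, fderivWithin_univ, hrz] at hr' hf' hker
  have hker' (v : E) (hv : fderiv ℝ (extChartAt I' (f z) ∘ f ∘ (extChartAt I z).symm)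
      (extChartAt I z z) v = 0) :
      fderiv ℝ (extChartAt I z ∘ r ∘ (extChartAt I z).symm) (extChartAt I z z) v = 0 := by
    have h : (fderiv ℝ (writtenInExtChartAt I I z r) (extChartAt I z z) : E →L[ℝ] E) v = 0 :=
      hker v hv
    rwa [writtenInExtChartAt, hrz] at h
  obtain ⟨k, hk, hkz, hky⟩ :=
    exists_contDiffAt_leftInverse_on_fixedPoints hr' hf' (by simp [hrz]) hker'
  simp only [Function.comp_apply, extChartAt_to_inv] at hk hkz
  have hsymm : ContMDiffAt 𝓘(ℝ, E) I ∞ (extChartAt I z).symm (k (extChartAt I' (f z) (f z))) := by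
    rw [hkz]
    exact (contMDiffOn_extChartAt_symm z).contMDiffAt (extChartAt_target_mem_nhds z)
  refine ⟨fun y => (extChartAt I z).symm (k (extChartAt I' (f z) y)),
    hsymm.comp (f z) (hk.contMDiffAt.comp (f z) contMDiffAt_extChartAt), ?_⟩
  filter_upwards [(continuousAt_extChartAt (I := I) z).eventually hky,
    extChartAt_source_mem_nhds (I := I) z] with y hy hyz hry
  simp only [Function.comp_apply, (extChartAt I z).left_inv hyz, hry, true_imp_iff] at hy
  rw [hy, (extChartAt I z).left_inv hyz]

theorem exists_contMDiffAt_localSection [I.Boundaryless] [IsManifold I ∞ M]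
    [FiniteDimensional ℝ E'] {f : M → M'} {z : M}
    (hf : ContMDiffAt I I' ∞ f z) (hsurj : Function.Surjective (mfderiv I I' f z)) :
    ∃ k : M' → M, ContMDiffAt I' I ∞ k (f z) ∧ k (f z) = z ∧ ∀ᶠ y in 𝓝 (f z), f (k y) = y := by
  have : CompleteSpace E' := FiniteDimensional.complete ℝ E'
  have hf' := (contMDiffAt_iff.1 hf).2
  rw [(hf.mdifferentiableAt (by simp)).mfderiv] at hsurj
  simp only [I.range_eq_univ, contDiffWithinAt_univ, fderivWithin_univ] at hf' hsurj
  obtain ⟨k, hk, hkz, hky⟩ := exists_contDiffAt_localSection hf' hsurj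
  simp only [Function.comp_apply, extChartAt_to_inv] at hk hkz hky
  have hsymm : ContMDiffAt 𝓘(ℝ, E) I ∞ (extChartAt I z).symm (k (extChartAt I' (f z) (f z))) := by
    rw [hkz]
    exact (contMDiffOn_extChartAt_symm z).contMDiffAt (extChartAt_target_mem_nhds z)
  have hsection : ContMDiffAt I' I ∞ (fun y => (extChartAt I z).symm (k (extChartAt I' (f z) y)))
      (f z) := hsymm.comp (f z) (hk.contMDiffAt.comp (f z) contMDiffAt_extChartAt)
  have hz : (extChartAt I z).symm (k (extChartAt I' (f z) (f z))) = z := by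
    rw [hkz, extChartAt_to_inv]
  have hlim := hsection.continuousAt
  rw [ContinuousAt, hz] at hlim
  refine ⟨_, hsection, hz, ?_⟩
  filter_upwards [(continuousAt_extChartAt (I := I') (f z)).eventually hky,
    extChartAt_source_mem_nhds (I := I') (f z),
    (hf.continuousAt.tendsto.comp hlim).eventually (extChartAt_source_mem_nhds (I := I') (f z))]
    with y hy hyz hkyz
  exact (extChartAt I' (f z)).injOn hkyz hyz hy

end Velocity

section FibreProjection

variable {E E' H H' M M' : Type*}
  [NormedAddCommGroup E] [NormedSpace ℝ E] [TopologicalSpace H] {I : ModelWithCorners ℝ E H}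
  [TopologicalSpace M] [ChartedSpace H M]
  [NormedAddCommGroup E'] [NormedSpace ℝ E'] [TopologicalSpace H'] {I' : ModelWithCorners ℝ E' H'}
  [TopologicalSpace M'] [ChartedSpace H' M'] {f : M → M'} {x : M}

/-- A smooth map `ρ` that moves a point `y` close to `x` to the fibre of `f` over a given point
close to `f x`, fixing `y` if it already is in that fibre. -/
structure IsFibreProjectionAt (I : ModelWithCorners ℝ E H) (I' : ModelWithCorners ℝ E' H')
    (f : M → M') (x : M) (ρ : M → M' → M) : Prop where
  smooth : ContMDiffAt (I.prod I') I ∞ (Function.uncurry ρ) (x, f x)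
  apply_self : ∀ᶠ y in 𝓝 x, ρ y (f y) = y
  map_apply : ∀ᶠ z in 𝓝 (x, f x), f (ρ z.1 z.2) = z.2

theorem IsFibreProjectionAt.hasVelocityAt {ρ : M → M' → M} (hρ : IsFibreProjectionAt I I' f x ρ)
    (hf : ContMDiffAt I I' ∞ f x) {γ : ℝ → M} {δ : ℝ → M'} {t : ℝ} {v : TangentSpace I x}
    (hγ : HasVelocityAt I γ t x v) (hδ : HasVelocityAt I' δ t (f x) (mfderiv I I' f x v)) :
    HasVelocityAt I (fun τ => ρ (γ τ) (δ τ)) t x v := by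
  have hρx : ρ x (f x) = x := hρ.apply_self.self_of_nhds
  have hγδ := ((hγ.prodMk hδ).comp hρ.smooth).congr_point hρx
  have hγf := ((hγ.prodMk (hγ.comp hf)).comp hρ.smooth).congr_point hρx
  have hργ : HasVelocityAt I (fun τ => ρ (γ τ) (f (γ τ))) t x v :=
    hγ.congr_of_eventuallyEq (hγ.tendsto.eventually hρ.apply_self)
  rwa [hγf.unique hργ] at hγδ

theorem IsFibreProjectionAt.exists_hasVelocityAt_lift [I.Boundaryless] [IsManifold I ∞ M]
    {ρ : M → M' → M} (hρ : IsFibreProjectionAt I I' f x ρ) (hf : ContMDiffAt I I' ∞ f x)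
    {v : TangentSpace I x} {δ : ℝ → M'}
    (hδ : HasVelocityAt I' δ 0 (f x) (mfderiv I I' f x v)) :
    ∃ γ, HasVelocityAt I γ 0 x v ∧ ∀ᶠ τ in 𝓝 0, f (γ τ) = δ τ := by
  obtain ⟨γ, hγ⟩ := exists_hasVelocityAt x v
  exact ⟨_, hρ.hasVelocityAt hf hγ hδ,
    (hγ.tendsto.prodMk_nhds hδ.tendsto).eventually hρ.map_apply⟩

/-- The point with the first coordinate of `b` and the second coordinate of `y`, in charts in which
the submersion `f` is the projection to the first coordinate. -/
noncomputable def submersionProjection (hf : Manifold.IsSubmersionAt I I' ∞ f x) (y : M) (b : M') :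
    M :=
  (hf.domChart.extend I).symm
    (hf.equiv.symm (hf.codChart.extend I' b, (hf.equiv (hf.domChart.extend I y)).2))

theorem submersionProjection_apply_self (hf : Manifold.IsSubmersionAt I I' ∞ f x) {y : M}
    (hy : y ∈ (hf.domChart.extend I).source) :
    hf.equiv.symm (hf.codChart.extend I' (f y), (hf.equiv (hf.domChart.extend I y)).2) =
        hf.domChart.extend I y ∧ submersionProjection hf y (f y) = y := by
  have hfy := hf.writtenInCharts ((hf.domChart.extend I).map_source hy)
  simp only [Function.comp_apply, (hf.domChart.extend I).left_inv hy] at hfy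
  have hcoord : hf.equiv.symm (hf.codChart.extend I' (f y),
      (hf.equiv (hf.domChart.extend I y)).2) = hf.domChart.extend I y := by
    rw [hfy]
    exact hf.equiv.symm_apply_apply _
  exact ⟨hcoord, by rw [submersionProjection, hcoord, (hf.domChart.extend I).left_inv hy]⟩

theorem map_submersionProjection (hf : Manifold.IsSubmersionAt I I' ∞ f x) {y : M} {b : M'}
    (hb : b ∈ (hf.codChart.extend I').source)
    (hyb : hf.equiv.symm (hf.codChart.extend I' b, (hf.equiv (hf.domChart.extend I y)).2) ∈
      (hf.domChart.extend I).target) : f (submersionProjection hf y b) = b := by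
  refine (hf.codChart.extend I').injOn ?_ hb ?_
  · have hsource := (hf.domChart.extend I).map_target hyb
    rw [OpenPartialHomeomorph.extend_source] at hsource ⊢
    exact hf.source_subset_preimage_source hsource
  · exact (hf.writtenInCharts hyb).trans (by simp)

theorem exists_isFibreProjectionAt [I.Boundaryless]
    (hf : Manifold.IsSubmersionAt I I' ∞ f x) : ∃ ρ, IsFibreProjectionAt I I' f x ρ := by
  set φ := hf.domChart.extend I
  set ψ := hf.codChart.extend I'
  have hφs : φ.source ∈ 𝓝 x := hf.domChart.extend_source_mem_nhds hf.mem_domChart_source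
  have hψs : ψ.source ∈ 𝓝 (f x) := hf.codChart.extend_source_mem_nhds hf.mem_codChart_source
  have hφt : φ.target ∈ 𝓝 (φ x) := by
    have h := hf.domChart.extend_target_mem_nhdsWithin (I := I) hf.mem_domChart_source
    rwa [I.range_eq_univ, nhdsWithin_univ] at h
  let coord : M × M' → E := fun z => hf.equiv.symm (ψ z.2, (hf.equiv (φ z.1)).2)
  have hcoord₀ : coord (x, f x) = φ x :=
    (submersionProjection_apply_self hf (mem_of_mem_nhds hφs)).1
  have hcoord : ContMDiffAt (I.prod I') 𝓘(ℝ, E) ∞ coord (x, f x) := by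
    have h₁ : ContMDiffAt (I.prod I') 𝓘(ℝ, E') ∞ (fun z : M × M' => ψ z.2) (x, f x) :=
      ContMDiffAt.comp (x, f x) (g := ψ) (hf.codChart.contMDiffAt_extend
        hf.codChart_mem_maximalAtlas hf.mem_codChart_source) contMDiffAt_snd
    have h₂ : ContMDiffAt (I.prod I') 𝓘(ℝ, E) ∞ (fun z : M × M' => φ z.1) (x, f x) :=
      ContMDiffAt.comp (x, f x) (g := φ) (hf.domChart.contMDiffAt_extend
        hf.domChart_mem_maximalAtlas hf.mem_domChart_source) contMDiffAt_fst
    exact ContMDiffAt.comp (x, f x) hf.equiv.symm.contDiff.contMDiff.contMDiffAt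
      (h₁.prodMk_space (ContMDiffAt.comp (x, f x) (g := fun e : E => (hf.equiv e).2)
        (contDiff_snd.comp hf.equiv.contDiff).contMDiff.contMDiffAt h₂))
  have hsymm : ContMDiffAt 𝓘(ℝ, E) I ∞ φ.symm (coord (x, f x)) := by
    rw [hcoord₀]
    refine (contMDiffOn_extend_symm hf.domChart_mem_maximalAtlas).contMDiffAt ?_
    rwa [← OpenPartialHomeomorph.extend_target']
  refine ⟨submersionProjection hf, hsymm.comp (x, f x) hcoord, ?_, ?_⟩
  · filter_upwards [hφs] with y hy using (submersionProjection_apply_self hf hy).2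
  · filter_upwards [hcoord.continuousAt.eventually (hcoord₀ ▸ hφt),
      continuousAt_snd.eventually hψs] with z hz hz₂
    exact map_submersionProjection hf hz₂ hz

end FibreProjection

section IntegralCurve

variable {E H M : Type*}
  [NormedAddCommGroup E] [NormedSpace ℝ E] [TopologicalSpace H] {I : ModelWithCorners ℝ E H}
  [TopologicalSpace M] [ChartedSpace H M]

theorem isMIntegralCurveAt_iff_hasVelocityAt {V : ∀ x : M, TangentSpace I x} {γ : ℝ → M} {t₀ : ℝ} :
    IsMIntegralCurveAt γ V t₀ ↔ ∀ᶠ t in 𝓝 t₀, HasVelocityAt I γ t (γ t) (V (γ t)) :=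
  eventually_congr (.of_forall fun _ => (and_iff_right rfl).symm)

theorem eventually_eq_of_isMIntegralCurveAt_of_eq_zero [I.Boundaryless] [IsManifold I 1 M]
    {V : ∀ x : M, TangentSpace I x} {x : M}
    (hV : ContMDiffAt I I.tangent 1 (fun y => (⟨y, V y⟩ : TangentBundle I M)) x) (hVx : V x = 0)
    {γ : ℝ → M} {t₀ : ℝ} (hγ : IsMIntegralCurveAt γ V t₀) (hγx : γ t₀ = x) :
    ∀ᶠ t in 𝓝 t₀, γ t = x := by
  subst hγx
  have hconst : IsMIntegralCurveAt (fun _ => γ t₀) V t₀ :=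
    isMIntegralCurveAt_iff_hasVelocityAt.2 (.of_forall fun t => hVx ▸ HasVelocityAt.const (γ t₀) t)
  exact isMIntegralCurveAt_eventuallyEq_of_contMDiffAt_boundaryless hV hγ hconst rfl

theorem eventually_eq_of_hasVelocityAt_zero [I.Boundaryless] [IsManifold I 1 M]
    {γ : ℝ → M} {t₀ : ℝ} (hγ : ∀ᶠ t in 𝓝 t₀, HasVelocityAt I γ t (γ t) 0) :
    ∀ᶠ t in 𝓝 t₀, γ t = γ t₀ :=
  eventually_eq_of_isMIntegralCurveAt_of_eq_zero (V := fun _ => 0)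
    (contMDiffAt_zeroSection ℝ (TangentSpace I : M → Type _)) rfl
    (isMIntegralCurveAt_iff_hasVelocityAt.2 hγ) rfl

variable (I) in
/-- The vector field generating a family of transformations `x ↦ Γ x τ` of `M` that is the identity
at `τ = 0`. -/
noncomputable def generator (Γ : M → ℝ → M) (x : M) : TangentSpace I x :=
  (mfderiv 𝓘(ℝ, ℝ) I (Γ x) 0 (1 : ℝ) : E)

variable {Γ : M → ℝ → M} {x : M}

theorem HasVelocityAt.generator_eq {v : TangentSpace I x} (h : HasVelocityAt I (Γ x) 0 x v) :
    generator I Γ x = v := by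
  rw [generator, h.2.mfderiv]
  exact one_smul ℝ (v : E)

theorem hasVelocityAt_generator (hΓ : MDifferentiableAt 𝓘(ℝ, ℝ) I (Γ x) 0) (hΓx : Γ x 0 = x) :
    HasVelocityAt I (Γ x) 0 x (generator I Γ x) := by
  refine ⟨hΓx, hΓ.hasMFDerivAt.congr_mfderiv (ContinuousLinearMap.ext fun τ : ℝ => ?_)⟩
  calc mfderiv 𝓘(ℝ, ℝ) I (Γ x) 0 τ = mfderiv 𝓘(ℝ, ℝ) I (Γ x) 0 (τ • (1 : ℝ)) := by
        rw [smul_eq_mul, mul_one]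
    _ = τ • mfderiv 𝓘(ℝ, ℝ) I (Γ x) 0 (1 : ℝ) := map_smul _ _ _

theorem eventually_hasVelocityAt_generator [IsManifold I ∞ M]
    (hΓ : ContMDiffAt (I.prod 𝓘(ℝ, ℝ)) I ∞ (Function.uncurry Γ) (x, 0))
    (hΓ₀ : ∀ᶠ y in 𝓝 x, Γ y 0 = y) :
    ∀ᶠ y in 𝓝 x, HasVelocityAt I (Γ y) 0 y (generator I Γ y) := by
  have : IsManifold I 1 M := .of_le (n := ∞) (by simp)
  have hsmooth : ∀ᶠ z in 𝓝 (x, (0 : ℝ)),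
      ContMDiffAt (I.prod 𝓘(ℝ, ℝ)) I 1 (Function.uncurry Γ) z :=
    (contMDiffAt_iff_contMDiffAt_nhds (by simp)).1 (hΓ.of_le (by decide))
  filter_upwards [(Continuous.prodMk_left (0 : ℝ)).continuousAt.eventually hsmooth, hΓ₀]
    with y hy hy₀
  have hΓy : ContMDiffAt 𝓘(ℝ, ℝ) I 1 (Γ y) 0 :=
    ContMDiffAt.comp (0 : ℝ) (f := fun τ : ℝ => (y, τ)) hy (contMDiffAt_const.prodMk contMDiffAt_id)
  exact hasVelocityAt_generator (hΓy.mdifferentiableAt (by simp)) hy₀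

theorem contMDiffAt_generator [IsManifold I ∞ M]
    (hΓ : ContMDiffAt (I.prod 𝓘(ℝ, ℝ)) I ∞ (Function.uncurry Γ) (x, 0))
    (hΓ₀ : ∀ᶠ y in 𝓝 x, Γ y 0 = y) :
    ContMDiffAt I I.tangent 1 (fun y => (⟨y, generator I Γ y⟩ : TangentBundle I M)) x := by
  have hderiv := hΓ.mfderiv Γ (fun _ => (0 : ℝ)) (m := 1) contMDiffAt_const
    (by decide)
  have hone : ContMDiffAt I 𝓘(ℝ, ℝ).tangent 1
      (fun _ : M => (⟨0, (1 : ℝ)⟩ : TangentBundle 𝓘(ℝ, ℝ) ℝ)) x := contMDiffAt_const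
  have hbase : ContMDiffAt I I 1 (fun y => Γ y 0) x :=
    contMDiffAt_id.congr_of_eventuallyEq hΓ₀
  have hsection := ContMDiffAt.clm_apply_of_inCoordinates
    (b₁ := fun _ => (0 : ℝ)) (v := fun _ => (1 : ℝ)) (b₂ := fun y => Γ y 0)
    (ϕ := fun y => mfderiv 𝓘(ℝ, ℝ) I (Γ y) 0) hderiv hone hbase
  refine hsection.congr_of_eventuallyEq ?_
  filter_upwards [hΓ₀] with y hy
  exact congrArg (fun m => (⟨m, (generator I Γ y : E)⟩ : TangentBundle I M)) hy.symm

end IntegralCurve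

section FibreProducts

variable {M N L : SmoothManifold.{u}}

theorem SmoothOn₂.hasVelocityAt {f : M → N → L} {s : Set (M × N)} (hf : SmoothOn₂ f s) {p : M}
    {q : N} (hpq : (p, q) ∈ s) {γ : ℝ → M} {δ : ℝ → N} {t : ℝ} {v : Tan M p} {w : Tan N q}
    (hγ : HasVelocityAt (𝓡 M.dim) γ t p v) (hδ : HasVelocityAt (𝓡 N.dim) δ t q w)
    (hs : ∀ᶠ τ in 𝓝 t, (γ τ, δ τ) ∈ s) :
    HasVelocityAt (𝓡 L.dim) (fun τ => f (γ τ) (δ τ)) t (f p q) (D₂ f s p q v w) :=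
  (hγ.prodMk hδ).comp_mfderivWithin ((hf (p, q) hpq).mdifferentiableWithinAt (by simp)) hs

theorem D₂_zero_zero (f : M → N → L) (s : Set (M × N)) (p : M) (q : N) : D₂ f s p q 0 0 = 0 :=
  map_zero (mfderivWithin ((𝓡 M.dim).prod (𝓡 N.dim)) (𝓡 L.dim) (fun z : M × N => f z.1 z.2) s
    (p, q))

theorem SmoothOn₂.contMDiffWithinAt_comp {f : M → N → L} {s : Set (M × N)} (hf : SmoothOn₂ f s)
    {E H A : Type*} [NormedAddCommGroup E] [NormedSpace ℝ E] [TopologicalSpace H]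
    {I : ModelWithCorners ℝ E H} [TopologicalSpace A] [ChartedSpace H A] {a : A → M} {b : A → N}
    {t : Set A} {x : A} (ha : ContMDiffWithinAt I (𝓡 M.dim) ∞ a t x)
    (hb : ContMDiffWithinAt I (𝓡 N.dim) ∞ b t x) (hx : x ∈ t)
    (hs : ∀ᶠ y in 𝓝[t] x, (a y, b y) ∈ s) :
    ContMDiffWithinAt I (𝓡 L.dim) ∞ (fun y => f (a y) (b y)) t x := by
  have h := (hf (a x, b x) (hs.self_of_nhdsWithin hx)).comp x
    ((ha.prodMk hb).mono (inter_subset_left (t := (fun y => (a y, b y)) ⁻¹' s)))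
    fun _ hy => hy.2
  exact h.mono_of_mem_nhdsWithin (inter_mem self_mem_nhdsWithin hs)

theorem SmoothOn₂.contMDiffAt_comp {f : M → N → L} {s : Set (M × N)} (hf : SmoothOn₂ f s)
    {E H A : Type*} [NormedAddCommGroup E] [NormedSpace ℝ E] [TopologicalSpace H]
    {I : ModelWithCorners ℝ E H} [TopologicalSpace A] [ChartedSpace H A] {a : A → M} {b : A → N}
    {x : A} (ha : ContMDiffAt I (𝓡 M.dim) ∞ a x) (hb : ContMDiffAt I (𝓡 N.dim) ∞ b x)
    (hs : ∀ᶠ y in 𝓝 x, (a y, b y) ∈ s) :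
    ContMDiffAt I (𝓡 L.dim) ∞ (fun y => f (a y) (b y)) x :=
  hf.contMDiffWithinAt_comp (t := univ) ha hb (mem_univ x) (by rwa [nhdsWithin_univ])

theorem IsSurjSubmersion.exists_isFibreProjectionAt {f : M → N} (hf : IsSurjSubmersion f) (x : M) :
    ∃ ρ, IsFibreProjectionAt (𝓡 M.dim) (𝓡 N.dim) f x ρ :=
  Pfaffian.exists_isFibreProjectionAt (hf.2.isSubmersionAt x)

theorem IsSurjSubmersion.exists_hasVelocityAt_of_D_eq {f : M → N} (hf : IsSurjSubmersion f)
    {g : L → N} (hg : ContMDiff (𝓡 L.dim) (𝓡 N.dim) ∞ g) {p : M} {q : L} (hpq : f p = g q)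
    {v : Tan M p} {w : Tan L q} (hvw : D f p v = D g q w) :
    ∃ γ δ, HasVelocityAt (𝓡 M.dim) γ 0 p v ∧ HasVelocityAt (𝓡 L.dim) δ 0 q w ∧
      ∀ᶠ τ in 𝓝 0, f (γ τ) = g (δ τ) := by
  obtain ⟨ρ, hρ⟩ := hf.exists_isFibreProjectionAt p
  obtain ⟨δ, hδ⟩ := exists_hasVelocityAt (I := 𝓡 L.dim) q w
  have hgδ : HasVelocityAt (𝓡 N.dim) (g ∘ δ) 0 (f p) (D f p v) := by
    rw [hvw]
    exact (hδ.comp hg.contMDiffAt).congr_point hpq.symm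
  obtain ⟨γ, hγ, hfγ⟩ := hρ.exists_hasVelocityAt_lift hf.2.contMDiff.contMDiffAt hgδ
  exact ⟨γ, δ, hγ, hδ, hfγ⟩

theorem IsSurjSubmersion.surjective_D {f : M → N} (hf : IsSurjSubmersion f) (p : M) :
    Function.Surjective (D f p) := by
  intro w
  obtain ⟨ρ, hρ⟩ := hf.exists_isFibreProjectionAt p
  obtain ⟨δ, hδ⟩ := exists_hasVelocityAt (I := 𝓡 N.dim) (f p) w
  have hγ := (((HasVelocityAt.const (I := 𝓡 M.dim) p 0).prodMk hδ).comp hρ.smooth).congr_point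
    (y := p) hρ.apply_self.self_of_nhds
  have hfγ : ∀ᶠ τ in 𝓝 0, f (ρ p (δ τ)) = δ τ :=
    (tendsto_const_nhds.prodMk_nhds hδ.tendsto).eventually hρ.map_apply
  exact ⟨_, (hγ.comp (f := f) hf.2.contMDiff.contMDiffAt).unique (hδ.congr_of_eventuallyEq hfγ)⟩

end FibreProducts

namespace LieGroupoid

variable {X : SmoothManifold.{u}} (S : LieGroupoid X)

theorem eq_inv_of_mul_eq_unit {g h : S.Arr} (hgh : S.src g = S.tgt h)
    (hmul : S.mul g h = S.unit (S.tgt g)) : h = S.inv g := by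
  have hinv : S.mul (S.inv g) (S.mul g h) = S.inv g := by rw [hmul, ← S.src_inv, S.mul_unit]
  rwa [← S.mul_assoc _ _ _ (S.src_inv g) hgh, S.inv_mul, hgh, S.unit_mul] at hinv

theorem inv_inv (g : S.Arr) : S.inv (S.inv g) = g := by
  refine (S.eq_inv_of_mul_eq_unit (S.src_inv g) ?_).symm
  rw [S.inv_mul, S.tgt_inv]

theorem mul_inv_cancel_left {g h : S.Arr} (hgh : S.tgt g = S.tgt h) :
    S.mul g (S.mul (S.inv g) h) = h := by
  rw [← S.mul_assoc _ _ _ (S.tgt_inv g).symm ((S.src_inv g).trans hgh), S.mul_inv, hgh, S.unit_mul]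

theorem unit_mul' (x : X) {g : S.Arr} (hg : S.tgt g = x) : S.mul (S.unit x) g = g :=
  hg ▸ S.unit_mul g

theorem mul_unit' {g : S.Arr} {x : X} (hg : S.src g = x) : S.mul g (S.unit x) = g :=
  hg ▸ S.mul_unit g

theorem inv_unit (x : X) : S.inv (S.unit x) = S.unit x := by
  refine (S.eq_inv_of_mul_eq_unit (by rw [S.src_unit, S.tgt_unit]) ?_).symm
  rw [S.unit_mul' x (S.tgt_unit x), S.tgt_unit]

theorem eq_unit_of_mul_self {g : S.Arr} (hg : S.src g = S.tgt g) (hmul : S.mul g g = g) :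
    g = S.unit (S.tgt g) := by
  have h := S.mul_assoc (S.inv g) g g (S.src_inv g) hg
  rwa [hmul, S.inv_mul, hg, S.unit_mul] at h

theorem inv_mul_rev {g h : S.Arr} (hgh : S.src g = S.tgt h) :
    S.inv (S.mul g h) = S.mul (S.inv h) (S.inv g) := by
  have hinv : S.src (S.inv h) = S.tgt (S.inv g) := by rw [S.src_inv, S.tgt_inv, hgh]
  have htgt : S.tgt (S.mul (S.inv h) (S.inv g)) = S.src h := by rw [S.tgt_mul _ _ hinv, S.tgt_inv]
  refine (S.eq_inv_of_mul_eq_unit (by rw [S.src_mul _ _ hgh, htgt]) ?_).symm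
  calc S.mul (S.mul g h) (S.mul (S.inv h) (S.inv g))
      = S.mul g (S.mul h (S.mul (S.inv h) (S.inv g))) := S.mul_assoc _ _ _ hgh htgt.symm
    _ = S.mul g (S.inv g) := by rw [S.mul_inv_cancel_left (by rw [S.tgt_inv, hgh])]
    _ = S.unit (S.tgt (S.mul g h)) := by rw [S.mul_inv, S.tgt_mul _ _ hgh]

theorem exists_isFibreProjectionAt_tgt (g : S.Arr) :
    ∃ ρ, IsFibreProjectionAt (𝓡 S.Arr.dim) (𝓡 X.dim) S.tgt g ρ := by
  obtain ⟨ρ, hsmooth, hself, hmap⟩ := S.submersion_src.exists_isFibreProjectionAt (S.inv g)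
  rw [S.src_inv g] at hsmooth hmap
  have hinv : Tendsto S.inv (𝓝 g) (𝓝 (S.inv g)) := S.inv.contMDiff.continuous.continuousAt
  refine ⟨fun h x => S.inv (ρ (S.inv h) x), ?_, ?_, ?_⟩
  · have hinv_fst : ContMDiffAt ((𝓡 S.Arr.dim).prod (𝓡 X.dim)) (𝓡 S.Arr.dim) ∞
        (fun z : S.Arr × X => S.inv z.1) (g, S.tgt g) :=
      S.inv.contMDiff.contMDiffAt.comp (g, S.tgt g) contMDiffAt_fst
    exact S.inv.contMDiff.contMDiffAt.comp (g, S.tgt g)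
      (ContMDiffAt.comp (g, S.tgt g) (g := Function.uncurry ρ) hsmooth
        (hinv_fst.prodMk contMDiffAt_snd))
  · filter_upwards [hinv.eventually hself] with h hh
    rw [← S.src_inv h, hh, S.inv_inv]
  · have hinv_prod : Tendsto (fun z : S.Arr × X => (S.inv z.1, z.2)) (𝓝 (g, S.tgt g))
        (𝓝 (S.inv g, S.tgt g)) :=
      (hinv.comp (continuousAt_fst (p := (g, S.tgt g)))).prodMk_nhds continuousAt_snd
    filter_upwards [hinv_prod.eventually hmap] with z hz
    rw [S.tgt_inv]
    exact hz

theorem exists_hasVelocityAt_of_D_tgt_eq_zero {g : S.Arr} {w : Tan S.Arr g}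
    (hw : D S.tgt g w = 0) :
    ∃ γ, HasVelocityAt (𝓡 S.Arr.dim) γ 0 g w ∧ ∀ᶠ τ in 𝓝 0, S.tgt (γ τ) = S.tgt g := by
  obtain ⟨ρ, hρ⟩ := S.exists_isFibreProjectionAt_tgt g
  refine hρ.exists_hasVelocityAt_lift S.tgt.contMDiff.contMDiffAt (δ := fun _ => S.tgt g) ?_
  exact (show mfderiv (𝓡 S.Arr.dim) (𝓡 X.dim) S.tgt g w = 0 from hw) ▸ HasVelocityAt.const _ _

theorem D_tgt_eq_zero {g : S.Arr} {γ : ℝ → S.Arr} {w : Tan S.Arr g}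
    (hγ : HasVelocityAt (𝓡 S.Arr.dim) γ 0 g w) (htgt : ∀ᶠ τ in 𝓝 0, S.tgt (γ τ) = S.tgt g) :
    D S.tgt g w = 0 :=
  (hγ.comp (f := S.tgt) S.tgt.contMDiff.contMDiffAt).unique
    ((HasVelocityAt.const (S.tgt g) 0).congr_of_eventuallyEq htgt)

theorem hasVelocityAt_mul {h g : S.Arr} (hhg : S.src h = S.tgt g) {γ : ℝ → S.Arr}
    {w : Tan S.Arr g} (hγ : HasVelocityAt (𝓡 S.Arr.dim) γ 0 g w)
    (htgt : ∀ᶠ τ in 𝓝 0, S.tgt (γ τ) = S.tgt g) :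
    HasVelocityAt (𝓡 S.Arr.dim) (fun τ => S.mul h (γ τ)) 0 (S.mul h g)
      (D₂ S.mul S.Composable h g 0 w) :=
  SmoothOn₂.hasVelocityAt (s := S.Composable) S.smooth_mul hhg (HasVelocityAt.const h 0) hγ
    (htgt.mono fun _ hτ => hhg.trans hτ.symm)

end LieGroupoid

section InfinitesimalAction

variable {X : SmoothManifold.{u}} {S : LieGroupoid X}

/-- A smooth family of arrows `e y τ` with target `y` that starts at the unit arrow at `τ = 0`. Its
velocity at `τ = 0` is a local section of the Lie algebroid of `S`. -/
structure IsUnitVariationAt (S : LieGroupoid X) (x : X) (e : X → ℝ → S.Arr) : Prop where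
  smooth : ContMDiffAt ((𝓡 X.dim).prod 𝓘(ℝ, ℝ)) (𝓡 S.Arr.dim) ∞ (Function.uncurry e) (x, 0)
  apply_zero : ∀ᶠ y in 𝓝 x, e y 0 = S.unit y
  tgt_apply : ∀ᶠ z in 𝓝 (x, (0 : ℝ)), S.tgt (e z.1 z.2) = z.1

theorem exists_isUnitVariationAt {x : X} {α : Tan S.Arr (S.unit x)}
    (hα : D S.tgt (S.unit x) α = 0) :
    ∃ e, IsUnitVariationAt S x e ∧ HasVelocityAt (𝓡 S.Arr.dim) (e x) 0 (S.unit x) α := by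
  obtain ⟨ρ, hρ⟩ := S.exists_isFibreProjectionAt_tgt (S.unit x)
  obtain ⟨c, hc, hc₀, hcα⟩ := exists_contMDiffAt_variation (S.unit.contMDiff.contMDiffAt (x := x)) α
  have hcx : ContMDiffAt ((𝓡 X.dim).prod 𝓘(ℝ, ℝ)) ((𝓡 S.Arr.dim).prod (𝓡 X.dim)) ∞
      (fun z : X × ℝ => (c z.1 z.2, z.1)) (x, 0) := hc.prodMk contMDiffAt_fst
  have hpoint : (c x 0, x) = (S.unit x, S.tgt (S.unit x)) := by rw [hcα.1, S.tgt_unit]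
  refine ⟨fun y τ => ρ (c y τ) y, ⟨?_, ?_, ?_⟩, ?_⟩
  · exact ContMDiffAt.comp (x, (0 : ℝ)) (g := Function.uncurry ρ) (hpoint ▸ hρ.smooth) hcx
  · filter_upwards [hc₀, S.unit.contMDiff.continuous.continuousAt.eventually hρ.apply_self]
      with y hy hρy
    rw [S.tgt_unit] at hρy
    rw [hy, hρy]
  · exact hcx.continuousAt.eventually (hpoint ▸ hρ.map_apply)
  · refine hρ.hasVelocityAt S.tgt.contMDiff.contMDiffAt hcα ?_
    rw [show mfderiv (𝓡 S.Arr.dim) (𝓡 X.dim) S.tgt (S.unit x) α = 0 from hα]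
    exact (HasVelocityAt.const x 0).congr_point (S.tgt_unit x).symm

variable {Q : SmoothManifold.{u}} {ν : SmoothMap Q X} {a : Q → S.Arr → Q} {e : X → ℝ → S.Arr}
  {q : Q}

/-- The vector field on `Q` induced by the family of arrows `e` under the right action `a` along
`ν`. -/
noncomputable def actionField (ν : Q → X) (a : Q → S.Arr → Q) (e : X → ℝ → S.Arr) (q : Q) :
    Tan Q q :=
  generator (𝓡 Q.dim) (fun q τ => a q (e (ν q) τ)) q

theorem IsUnitVariationAt.eventually_tgt_apply (he : IsUnitVariationAt S (ν q) e) :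
    ∀ᶠ z in 𝓝 (q, (0 : ℝ)), ν z.1 = S.tgt (e (ν z.1) z.2) := by
  have hν : Tendsto (fun z : Q × ℝ => (ν z.1, z.2)) (𝓝 (q, 0)) (𝓝 (ν q, 0)) :=
    (ν.contMDiff.continuous.continuousAt.comp continuousAt_fst).prodMk_nhds continuousAt_snd
  exact (hν.eventually he.tgt_apply).mono fun _ => Eq.symm

theorem IsUnitVariationAt.contMDiffAt_act (he : IsUnitVariationAt S (ν q) e)
    (ha : SmoothOn₂ a {z | ν z.1 = S.tgt z.2}) :
    ContMDiffAt ((𝓡 Q.dim).prod 𝓘(ℝ, ℝ)) (𝓡 Q.dim) ∞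
      (Function.uncurry fun q τ => a q (e (ν q) τ)) (q, 0) :=
  ha.contMDiffAt_comp contMDiffAt_fst
    (ContMDiffAt.comp (q, (0 : ℝ)) (g := Function.uncurry e) he.smooth
      ((ν.contMDiff.contMDiffAt.comp (q, (0 : ℝ)) contMDiffAt_fst).prodMk contMDiffAt_snd))
    he.eventually_tgt_apply

theorem IsUnitVariationAt.eventually_act_zero (he : IsUnitVariationAt S (ν q) e)
    (ha_unit : ∀ q, a q (S.unit (ν q)) = q) : ∀ᶠ r in 𝓝 q, a r (e (ν r) 0) = r := by
  filter_upwards [ν.contMDiff.continuous.continuousAt.eventually he.apply_zero] with r hr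
  rw [hr, ha_unit]

theorem IsUnitVariationAt.contMDiffAt_actionField (he : IsUnitVariationAt S (ν q) e)
    (ha : SmoothOn₂ a {z | ν z.1 = S.tgt z.2}) (ha_unit : ∀ q, a q (S.unit (ν q)) = q) :
    ContMDiffAt (𝓡 Q.dim) (𝓡 Q.dim).tangent 1
      (fun q => (⟨q, actionField ν a e q⟩ : TangentBundle (𝓡 Q.dim) Q)) q :=
  contMDiffAt_generator (he.contMDiffAt_act ha) (he.eventually_act_zero ha_unit)

theorem IsUnitVariationAt.eventually_hasVelocityAt_actionField (he : IsUnitVariationAt S (ν q) e)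
    (ha : SmoothOn₂ a {z | ν z.1 = S.tgt z.2}) (ha_unit : ∀ q, a q (S.unit (ν q)) = q) :
    ∀ᶠ r in 𝓝 q,
      HasVelocityAt (𝓡 Q.dim) (fun τ => a r (e (ν r) τ)) 0 r (actionField ν a e r) :=
  eventually_hasVelocityAt_generator (he.contMDiffAt_act ha) (he.eventually_act_zero ha_unit)

theorem IsUnitVariationAt.exists_integralCurve {x : X} (he : IsUnitVariationAt S x e) :
    ∃ c : ℝ → S.Arr, c 0 = S.unit x ∧ ∀ᶠ t in 𝓝 0, S.tgt (c t) = x ∧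
      HasVelocityAt (𝓡 S.Arr.dim) c t (c t) (actionField S.src S.mul e (c t)) ∧
      (∀ᶠ τ in 𝓝 0, S.src (c t) = S.tgt (e (S.src (c t)) τ)) ∧
      HasVelocityAt (𝓡 S.Arr.dim) (fun τ => S.mul (c t) (e (S.src (c t)) τ)) 0 (c t)
        (actionField S.src S.mul e (c t)) := by
  replace he : IsUnitVariationAt S (S.src (S.unit x)) e := (S.src_unit x).symm ▸ he
  obtain ⟨c, hc₀, hc⟩ := exists_isMIntegralCurveAt_of_contMDiffAt_boundaryless 0
    (he.contMDiffAt_actionField S.smooth_mul S.mul_unit)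
  rw [isMIntegralCurveAt_iff_hasVelocityAt] at hc
  have hc_tendsto : Tendsto c (𝓝 0) (𝓝 (S.unit x)) := hc₀ ▸ hc.self_of_nhds.tendsto
  have hc_tgt_apply := hc_tendsto.eventually he.eventually_tgt_apply.curry_nhds
  have hc_mul := hc_tendsto.eventually
    (he.eventually_hasVelocityAt_actionField S.smooth_mul S.mul_unit)
  have hc_tgt : ∀ᶠ t in 𝓝 0, S.tgt (c t) = S.tgt (c 0) := by
    refine eventually_eq_of_hasVelocityAt_zero (I := 𝓡 X.dim) (γ := S.tgt ∘ c) ?_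
    filter_upwards [hc, hc_tgt_apply, hc_mul] with t ht ht_tgt ht_mul
    have h := ht.comp (f := S.tgt) S.tgt.contMDiff.contMDiffAt
    rwa [show mfderiv (𝓡 S.Arr.dim) (𝓡 X.dim) S.tgt (c t) (actionField S.src S.mul e (c t)) = 0
      from S.D_tgt_eq_zero ht_mul (ht_tgt.mono fun _ hτ => S.tgt_mul _ _ hτ)] at h
  rw [hc₀, S.tgt_unit] at hc_tgt
  refine ⟨c, hc₀, ?_⟩
  filter_upwards [hc_tgt, hc, hc_tgt_apply, hc_mul] with t h₁ h₂ h₃ h₄ using ⟨h₁, h₂, h₃, h₄⟩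

theorem IsUnitVariationAt.actionField_unit {x : X} (he : IsUnitVariationAt S x e)
    {α : Tan S.Arr (S.unit x)} (heα : HasVelocityAt (𝓡 S.Arr.dim) (e x) 0 (S.unit x) α) :
    actionField S.src S.mul e (S.unit x) = α := by
  refine HasVelocityAt.generator_eq (heα.congr_of_eventuallyEq ?_)
  filter_upwards [he.tgt_apply.curry_nhds.self_of_nhds] with τ hτ
  rw [S.src_unit, S.unit_mul' x hτ]

end InfinitesimalAction

namespace IsRightPrincipal

variable {X P M : SmoothManifold.{u}} {S : LieGroupoid X} {μ : SmoothMap P X} {proj : SmoothMap P M}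
  {act : P → S.Arr → P} {p : P} {e : X → ℝ → S.Arr}

theorem hasVelocityAt_act (h : IsRightPrincipal S μ proj act) {g : S.Arr} (hpg : μ p = S.tgt g)
    {γ : ℝ → S.Arr} {t : ℝ} {w : Tan S.Arr g} (hγ : HasVelocityAt (𝓡 S.Arr.dim) γ t g w)
    (htgt : ∀ᶠ τ in 𝓝 t, S.tgt (γ τ) = S.tgt g) :
    HasVelocityAt (𝓡 P.dim) (fun τ => act p (γ τ)) t (act p g)
      (D₂ act {z | μ z.1 = S.tgt z.2} p g 0 w) :=
  h.smooth_act.hasVelocityAt (p := p) (q := g) hpg (HasVelocityAt.const p t) hγ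
    (htgt.mono fun _ hτ => hpg.trans hτ.symm)

theorem D₂_act_actionField_mul (h : IsRightPrincipal S μ proj act) {g : S.Arr}
    (hpg : μ p = S.tgt g) (he : ∀ᶠ τ in 𝓝 (0 : ℝ), S.src g = S.tgt (e (S.src g) τ))
    (hfield : HasVelocityAt (𝓡 S.Arr.dim) (fun τ => S.mul g (e (S.src g) τ)) 0 g
      (actionField S.src S.mul e g)) :
    D₂ act {z | μ z.1 = S.tgt z.2} p g 0 (actionField S.src S.mul e g) =
      actionField μ act e (act p g) := by
  refine (HasVelocityAt.generator_eq ((h.hasVelocityAt_act hpg hfield ?_).congr_of_eventuallyEq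
    ?_)).symm
  · exact he.mono fun τ hτ => S.tgt_mul _ _ hτ
  · filter_upwards [he] with τ hτ
    rw [h.μ_act p g hpg, h.act_mul p g _ hpg hτ]

/- The integral curve of the left-invariant vector field of `α` through the unit is mapped by the
action on `p` to an integral curve starting at a zero, so it is constant as the action is free. -/
theorem eq_zero_of_D₂_act_unit_eq_zero (h : IsRightPrincipal S μ proj act)
    {α : Tan S.Arr (S.unit (μ p))} (hα : D S.tgt (S.unit (μ p)) α = 0)
    (hact : D₂ act {z | μ z.1 = S.tgt z.2} p (S.unit (μ p)) 0 α = 0) : α = 0 := by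
  obtain ⟨e, he, heα⟩ := exists_isUnitVariationAt hα
  obtain ⟨c, hc₀, hc⟩ := he.exists_integralCurve
  have hzero : actionField μ act e p = 0 := by
    have h_act := h.hasVelocityAt_act (S.tgt_unit (μ p)).symm heα
      (he.tgt_apply.curry_nhds.self_of_nhds.mono fun _ hτ => hτ.trans (S.tgt_unit _).symm)
    rw [hact] at h_act
    exact (h_act.congr_point (h.act_unit p)).generator_eq
  have hcurve : IsMIntegralCurveAt (fun t => act p (c t)) (actionField μ act e) 0 := by
    refine isMIntegralCurveAt_iff_hasVelocityAt.2 ?_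
    filter_upwards [hc, hc.eventually_nhds] with t ⟨ht, hct, hτ, hfield⟩ hnear
    rw [← h.D₂_act_actionField_mul ht.symm hτ hfield]
    exact h.hasVelocityAt_act ht.symm hct (hnear.mono fun _ hs => hs.1.trans ht.symm)
  have hconst : ∀ᶠ t in 𝓝 0, act p (c t) = p :=
    eventually_eq_of_isMIntegralCurveAt_of_eq_zero
      (he.contMDiffAt_actionField h.smooth_act h.act_unit) hzero hcurve
      (by rw [hc₀, h.act_unit])
  have hc_unit : ∀ᶠ t in 𝓝 0, c t = S.unit (μ p) := by
    filter_upwards [hc, hconst] with t ht hpt using h.free p _ ht.1.symm hpt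
  have hvelocity := hc.self_of_nhds.2.1
  rw [hc₀, he.actionField_unit heα] at hvelocity
  exact hvelocity.unique ((HasVelocityAt.const _ 0).congr_of_eventuallyEq hc_unit)

theorem eq_zero_of_D₂_act_eq_zero (h : IsRightPrincipal S μ proj act) {g : S.Arr}
    (hpg : μ p = S.tgt g) {w : Tan S.Arr g} (hw : D S.tgt g w = 0)
    (hact : D₂ act {z | μ z.1 = S.tgt z.2} p g 0 w = 0) : w = 0 := by
  obtain ⟨γ, hγ, hγ_tgt⟩ := S.exists_hasVelocityAt_of_D_tgt_eq_zero hw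
  have hpg_src : μ (act p g) = S.src g := h.μ_act p g hpg
  have hinv : S.src (S.inv g) = S.tgt g := S.src_inv g
  have hunit : S.mul (S.inv g) g = S.unit (μ (act p g)) := by rw [S.inv_mul, hpg_src]
  have hδ := (S.hasVelocityAt_mul hinv hγ hγ_tgt).congr_point hunit
  set α : Tan S.Arr (S.unit (μ (act p g))) := D₂ S.mul S.Composable (S.inv g) g 0 w
  have hδ_tgt : ∀ᶠ τ in 𝓝 0,
      S.tgt (S.mul (S.inv g) (γ τ)) = S.tgt (S.unit (μ (act p g))) := by
    filter_upwards [hγ_tgt] with τ hτ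
    rw [S.tgt_mul _ _ (hinv.trans hτ.symm), S.tgt_inv, S.tgt_unit, hpg_src]
  have hα : α = 0 := by
    refine h.eq_zero_of_D₂_act_unit_eq_zero (S.D_tgt_eq_zero hδ hδ_tgt) ?_
    have hγ_act := h.hasVelocityAt_act hpg hγ hγ_tgt
    rw [hact] at hγ_act
    refine (h.hasVelocityAt_act (S.tgt_unit _).symm hδ hδ_tgt).unique
      ((hγ_act.congr_of_eventuallyEq ?_).congr_point (h.act_unit _).symm)
    filter_upwards [hγ_tgt] with τ hτ
    rw [← h.act_mul _ _ _ hpg (by rw [S.tgt_mul _ _ (hinv.trans hτ.symm), S.tgt_inv]),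
      S.mul_inv_cancel_left hτ.symm]
  rw [hα] at hδ
  have hg_unit : S.src g = S.tgt (S.unit (μ (act p g))) := by rw [S.tgt_unit, hpg_src]
  have hzero := S.hasVelocityAt_mul hg_unit hδ hδ_tgt
  rw [D₂_zero_zero] at hzero
  refine hγ.unique ((hzero.congr_of_eventuallyEq ?_).congr_point (S.mul_unit' hpg_src.symm))
  filter_upwards [hγ_tgt] with τ hτ
  rw [S.mul_inv_cancel_left hτ.symm]

end IsRightPrincipal

section FibreProductCharts

variable {M N L : SmoothManifold.{u}} {f : M → N} {g : L → N} {p : M} {q : L}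

theorem IsSurjSubmersion.exists_fibreProduct_retraction (hf : IsSurjSubmersion f)
    (hg : ContMDiff (𝓡 L.dim) (𝓡 N.dim) ∞ g) (hpq : f p = g q) :
    ∃ r : M × L → M × L,
      ContMDiffAt ((𝓡 M.dim).prod (𝓡 L.dim)) ((𝓡 M.dim).prod (𝓡 L.dim)) ∞ r (p, q) ∧
      (∀ᶠ z in 𝓝 (p, q), f (r z).1 = g (r z).2) ∧
      ∀ᶠ z in 𝓝 (p, q), f z.1 = g z.2 → r z = z := by
  obtain ⟨ρ, hsmooth, hself, hmap⟩ := hf.exists_isFibreProjectionAt p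
  rw [hpq] at hsmooth hmap
  have hbase : ContMDiffAt ((𝓡 M.dim).prod (𝓡 L.dim)) ((𝓡 M.dim).prod (𝓡 N.dim)) ∞
      (fun z : M × L => (z.1, g z.2)) (p, q) :=
    contMDiffAt_fst.prodMk (hg.contMDiffAt.comp (p, q) contMDiffAt_snd)
  refine ⟨fun z => (ρ z.1 (g z.2), z.2), ?_, hbase.continuousAt.eventually hmap, ?_⟩
  · exact (ContMDiffAt.comp (p, q) (g := Function.uncurry ρ) hsmooth hbase).prodMk contMDiffAt_snd
  · filter_upwards [(continuousAt_fst (p := (p, q))).eventually hself] with z hz hfg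
    rw [← hfg, hz]

theorem IsSurjSubmersion.exists_leftInverse_fibreProduct (hf : IsSurjSubmersion f)
    (hg : ContMDiff (𝓡 L.dim) (𝓡 N.dim) ∞ g) (hpq : f p = g q) {E H A : Type*}
    [NormedAddCommGroup E] [NormedSpace ℝ E] [FiniteDimensional ℝ E] [TopologicalSpace H]
    {I : ModelWithCorners ℝ E H} [TopologicalSpace A] [ChartedSpace H A] {φ : M × L → A}
    (hφ : ContMDiffOn ((𝓡 M.dim).prod (𝓡 L.dim)) I ∞ φ {z | f z.1 = g z.2})
    (hker : ∀ (v : Tan M p) (w : Tan L q), D f p v = D g q w →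
      mfderivWithin ((𝓡 M.dim).prod (𝓡 L.dim)) I φ {z | f z.1 = g z.2} (p, q) (v, w) = 0 →
      v = 0 ∧ w = 0) :
    ∃ k : A → M × L, ContMDiffAt I ((𝓡 M.dim).prod (𝓡 L.dim)) ∞ k (φ (p, q)) ∧
      ∀ᶠ z in 𝓝 (p, q), f z.1 = g z.2 → k (φ z) = z := by
  obtain ⟨r, hr, hmem, hfix⟩ := hf.exists_fibreProduct_retraction hg hpq
  have hr₀ : r (p, q) = (p, q) := hfix.self_of_nhds hpq
  have hφr : ContMDiffAt ((𝓡 M.dim).prod (𝓡 L.dim)) I ∞ (φ ∘ r) (p, q) :=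
    ((hφ (p, q) hpq).comp_of_eq hr.contMDiffWithinAt (mapsTo_preimage r _) hr₀).contMDiffAt hmem
  obtain ⟨k, hk, hkφ⟩ := exists_contMDiffAt_leftInverse_on_fixedPoints hr hφr hr₀ fun u hu => by
    obtain ⟨η, hη⟩ := exists_hasVelocityAt (I := (𝓡 M.dim).prod (𝓡 L.dim)) (p, q) u
    have hrη := (hη.comp hr).congr_point hr₀
    have hrη_mem : ∀ᶠ τ in 𝓝 0, f (r (η τ)).1 = g (r (η τ)).2 := hη.tendsto.eventually hmem
    have hφrη := hrη.comp_mfderivWithin ((hφ (p, q) hpq).mdifferentiableWithinAt (by simp)) hrη_mem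
    have hzero := (hη.comp hφr).congr_point (congrArg φ hr₀)
    rw [hu] at hzero
    have htangent := ((hrη.fst).comp (f := f) hf.2.contMDiff.contMDiffAt).unique
      ((((hrη.snd).comp (f := g) hg.contMDiffAt).congr_of_eventuallyEq hrη_mem).congr_point
        hpq.symm)
    obtain ⟨hv, hw⟩ := hker _ _ htangent (hφrη.unique hzero)
    exact Prod.ext hv hw
  simp only [Function.comp_apply, hr₀] at hk
  refine ⟨k, hk, ?_⟩
  filter_upwards [hkφ, hfix] with z hkz hrz hz
  have h := hkz (hrz hz)
  rwa [Function.comp_apply, hrz hz] at h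

theorem IsSurjSubmersion.exists_localSection_fibreProduct (hf : IsSurjSubmersion f)
    (hg : ContMDiff (𝓡 L.dim) (𝓡 N.dim) ∞ g) (hpq : f p = g q) {K : SmoothManifold.{u}}
    {φ : M → L → K} (hφ : SmoothOn₂ φ {z | f z.1 = g z.2})
    (hsurj : ∀ u : Tan K (φ p q), ∃ (v : Tan M p) (w : Tan L q), D f p v = D g q w ∧
      D₂ φ {z | f z.1 = g z.2} p q v w = u) :
    ∃ k : K → M × L, ContMDiffAt (𝓡 K.dim) ((𝓡 M.dim).prod (𝓡 L.dim)) ∞ k (φ p q) ∧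
      ∀ᶠ y in 𝓝 (φ p q), f (k y).1 = g (k y).2 ∧ φ (k y).1 (k y).2 = y := by
  obtain ⟨r, hr, hmem, hfix⟩ := hf.exists_fibreProduct_retraction hg hpq
  have hr₀ : r (p, q) = (p, q) := hfix.self_of_nhds hpq
  have hφr₀ : φ (r (p, q)).1 (r (p, q)).2 = φ p q := by rw [hr₀]
  have hφr := hφ.contMDiffAt_comp (contMDiffAt_fst.comp (p, q) hr)
    (contMDiffAt_snd.comp (p, q) hr) hmem
  obtain ⟨k, hk, hk₀, hkφ⟩ := exists_contMDiffAt_localSection hφr fun u => by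
    obtain ⟨v, w, hvw, hu⟩ := hsurj (u : EuclideanSpace ℝ (Fin K.dim))
    obtain ⟨γ, δ, hγ, hδ, hγδ⟩ := hf.exists_hasVelocityAt_of_D_eq hg hpq hvw
    have hφγδ := hφ.hasVelocityAt hpq hγ hδ hγδ
    rw [hu] at hφγδ
    refine ⟨(v, w), ((hγ.prodMk hδ).comp hφr).unique
      ((hφγδ.congr_of_eventuallyEq ?_).congr_point hφr₀.symm)⟩
    filter_upwards [hγδ, (hγ.prodMk hδ).tendsto.eventually hfix] with τ hτ hrτ
    simp only [Function.comp_apply, hrτ hτ]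
  simp only [Function.comp_apply, hφr₀] at hk hk₀ hkφ
  refine ⟨r ∘ k, ContMDiffAt.comp _ (hk₀ ▸ hr) hk, ?_⟩
  have hk_tendsto : Tendsto k (𝓝 (φ p q)) (𝓝 (p, q)) := by
    simpa only [hk₀] using hk.continuousAt.tendsto
  filter_upwards [hk_tendsto.eventually hmem, hkφ] with y hy hφy using ⟨hy, hφy⟩

end FibreProductCharts

namespace IsRightPrincipal

variable {X P M : SmoothManifold.{u}} {S : LieGroupoid X} {μ : SmoothMap P X} {proj : SmoothMap P M}
  {act : P → S.Arr → P}

theorem act_left_cancel (h : IsRightPrincipal S μ proj act) {p : P} {g g' : S.Arr}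
    (hg : μ p = S.tgt g) (hg' : μ p = S.tgt g') (heq : act p g = act p g') : g = g' := by
  have hinv : S.src g' = S.tgt (S.inv g') := (S.tgt_inv g').symm
  have hcomp : S.src g = S.tgt (S.inv g') := by rw [← h.μ_act _ _ hg, heq, h.μ_act _ _ hg', hinv]
  have hfix : act p (S.mul g (S.inv g')) = p := by
    rw [h.act_mul _ _ _ hg hcomp, heq, ← h.act_mul _ _ _ hg' hinv, S.mul_inv, ← hg', h.act_unit]
  have hunit := h.free p _ (by rw [S.tgt_mul _ _ hcomp, hg]) hfix
  have hinv_eq := S.eq_inv_of_mul_eq_unit hcomp (by rw [hunit, hg])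
  rw [← S.inv_inv g', hinv_eq, S.inv_inv]

open scoped Classical in
/-- The division map of a right principal bundle: `p · division p p' = p'` for `p`, `p'` in the same
fibre. Outside the fibre product its value is the unit at `μ p`. -/
noncomputable def division (h : IsRightPrincipal S μ proj act) (p p' : P) : S.Arr :=
  if hp : proj p = proj p' then (h.transitive p p' hp).choose else S.unit (μ p)

theorem tgt_division (h : IsRightPrincipal S μ proj act) {p p' : P} (hp : proj p = proj p') :
    S.tgt (h.division p p') = μ p := by
  rw [division, dif_pos hp]
  exact (h.transitive p p' hp).choose_spec.1.symm

theorem act_division (h : IsRightPrincipal S μ proj act) {p p' : P} (hp : proj p = proj p') :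
    act p (h.division p p') = p' := by
  rw [division, dif_pos hp]
  exact (h.transitive p p' hp).choose_spec.2

theorem division_eq (h : IsRightPrincipal S μ proj act) {p p' : P} {g : S.Arr}
    (hg : μ p = S.tgt g) (heq : act p g = p') : h.division p p' = g := by
  have hp : proj p = proj p' := by rw [← heq, h.proj_act p g hg]
  exact h.act_left_cancel (h.tgt_division hp).symm hg ((h.act_division hp).trans heq.symm)

theorem src_division (h : IsRightPrincipal S μ proj act) {p p' : P} (hp : proj p = proj p') :
    S.src (h.division p p') = μ p' := by
  rw [← h.μ_act _ _ (h.tgt_division hp).symm, h.act_division hp]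

theorem isClosedEmbedding_act (h : IsRightPrincipal S μ proj act) :
    IsClosedEmbedding
      fun z : {z : P × S.Arr // μ z.1 = S.tgt z.2} => (z.1.1, act z.1.1 z.1.2) := by
  refine .of_continuous_injective_isClosedMap h.proper.continuous ?_ h.proper.isClosedMap
  rintro ⟨⟨p, g⟩, hg⟩ ⟨⟨p', g'⟩, hg'⟩ heq
  obtain ⟨rfl, hact⟩ := Prod.mk.inj heq
  exact Subtype.ext (Prod.ext rfl (h.act_left_cancel hg hg' hact))

theorem continuousOn_division (h : IsRightPrincipal S μ proj act) :
    ContinuousOn (fun z : P × P => h.division z.1 z.2) {z | proj z.1 = proj z.2} := by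
  rw [continuousOn_iff_continuous_domRestrict]
  let lift (z : {z : P × P | proj z.1 = proj z.2}) : {z : P × S.Arr // μ z.1 = S.tgt z.2} :=
    ⟨(z.1.1, h.division z.1.1 z.1.2), (h.tgt_division z.2).symm⟩
  have hlift : Continuous lift := by
    rw [h.isClosedEmbedding_act.isInducing.continuous_iff]
    exact continuous_subtype_val.congr fun z => Prod.ext rfl (h.act_division z.2).symm
  exact continuous_snd.comp (continuous_subtype_val.comp hlift)

theorem exists_leftInverse_act (h : IsRightPrincipal S μ proj act) {p : P} {g : S.Arr}
    (hpg : μ p = S.tgt g) :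
    ∃ k : P × P → P × S.Arr,
      ContMDiffAt ((𝓡 P.dim).prod (𝓡 P.dim)) ((𝓡 P.dim).prod (𝓡 S.Arr.dim)) ∞ k (p, act p g) ∧
      ∀ᶠ z in 𝓝 (p, g), μ z.1 = S.tgt z.2 → k (z.1, act z.1 z.2) = z := by
  have hsmooth : ContMDiffOn ((𝓡 P.dim).prod (𝓡 S.Arr.dim)) ((𝓡 P.dim).prod (𝓡 P.dim)) ∞
      (fun z : P × S.Arr => (z.1, act z.1 z.2)) {z | μ z.1 = S.tgt z.2} :=
    contMDiffOn_fst.prodMk h.smooth_act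
  refine h.submersion_μ.exists_leftInverse_fibreProduct S.tgt.contMDiff hpg hsmooth
    fun v w hvw hzero => ?_
  obtain ⟨γ, δ, hγ, hδ, hγδ⟩ :=
    h.submersion_μ.exists_hasVelocityAt_of_D_eq S.tgt.contMDiff hpg hvw
  have hpair := (hγ.prodMk hδ).comp_mfderivWithin
    ((hsmooth (p, g) hpg).mdifferentiableWithinAt (by simp)) hγδ
  rw [hzero] at hpair
  have hv : v = 0 := hγ.unique hpair.fst
  subst hv
  have hact := (h.smooth_act.hasVelocityAt hpg hγ hδ hγδ).unique hpair.snd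
  exact ⟨rfl, h.eq_zero_of_D₂_act_eq_zero hpg (hvw.symm.trans (map_zero _)) hact⟩

theorem smooth_division (h : IsRightPrincipal S μ proj act) :
    SmoothOn₂ h.division {z | proj z.1 = proj z.2} := by
  rintro ⟨p, p'⟩ hp
  obtain ⟨k, hk, hkact⟩ := h.exists_leftInverse_act (h.tgt_division hp).symm
  rw [h.act_division hp] at hk
  refine (contMDiffAt_snd.comp (p, p') hk).contMDiffWithinAt.congr_of_eventuallyEq_of_mem ?_ hp
  have htendsto : Tendsto (fun z : P × P => (z.1, h.division z.1 z.2))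
      (𝓝[{z | proj z.1 = proj z.2}] (p, p')) (𝓝 (p, h.division p p')) :=
    (continuousAt_fst.mono_left nhdsWithin_le_nhds).prodMk_nhds (h.continuousOn_division (p, p') hp)
  filter_upwards [htendsto.eventually hkact, self_mem_nhdsWithin] with z hz hz_mem
  have hkz := hz (h.tgt_division hz_mem).symm
  rw [h.act_division hz_mem] at hkz
  exact (congrArg Prod.snd hkz).symm

end IsRightPrincipal

section LeftToRight

variable {X P M : SmoothManifold.{u}} {S : LieGroupoid X} {μ : SmoothMap P X} {proj : SmoothMap P M}

/-- The homeomorphism `(p, g) ↦ (g⁻¹, p)` from the fibre product on which a right action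
is defined to the one on which a left action is defined. -/
noncomputable def invSwapHomeomorph (S : LieGroupoid X) (μ : SmoothMap P X) :
    {z : P × S.Arr // μ z.1 = S.tgt z.2} ≃ₜ {z : S.Arr × P // S.src z.1 = μ z.2} where
  toFun z := ⟨(S.inv z.1.2, z.1.1), (S.src_inv _).trans z.2.symm⟩
  invFun z := ⟨(z.1.2, S.inv z.1.1), z.2.symm.trans (S.tgt_inv _).symm⟩
  left_inv z := by simp only [S.inv_inv]
  right_inv z := by simp only [S.inv_inv]
  continuous_toFun := by
    have hinv := S.inv.contMDiff.continuous
    fun_prop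
  continuous_invFun := by
    have hinv := S.inv.contMDiff.continuous
    fun_prop

theorem IsLeftPrincipal.isRightPrincipal {act : S.Arr → P → P} (h : IsLeftPrincipal S μ proj act) :
    IsRightPrincipal S μ proj (fun p g => act (S.inv g) p) where
  smooth_act := by
    refine ContMDiffOn.comp (t := {z : S.Arr × P | S.src z.1 = μ z.2})
      (f := fun z : P × S.Arr => (S.inv z.2, z.1)) h.smooth_act ?_ fun z hz => ?_
    · exact ((S.inv.contMDiff.comp contMDiff_snd).prodMk contMDiff_fst).contMDiffOn
    · exact (S.src_inv _).trans (Eq.symm hz)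
  μ_act p g hg := by rw [h.μ_act _ _ ((S.src_inv g).trans hg.symm), S.tgt_inv]
  act_mul p g k hg hgk := by
    rw [S.inv_mul_rev hgk, h.mul_act _ _ _ (by rw [S.src_inv, S.tgt_inv, hgk])
      ((S.src_inv g).trans hg.symm)]
  act_unit p := by rw [S.inv_unit, h.unit_act]
  submersion_μ := h.submersion_μ
  submersion_proj := h.submersion_proj
  proj_act p g hg := h.proj_act _ _ ((S.src_inv g).trans hg.symm)
  transitive p p' hp := by
    obtain ⟨g, hg, hact⟩ := h.transitive p p' hp
    exact ⟨S.inv g, by rw [S.tgt_inv, hg], by rw [S.inv_inv, hact]⟩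
  free p g hg hact := by
    rw [← S.inv_inv g, h.free _ _ ((S.src_inv g).trans hg.symm) hact, S.inv_unit]
  proper := ((Homeomorph.prodComm P P).isProperMap.comp h.proper).comp
    (invSwapHomeomorph S μ).isProperMap
  t2_base := h.t2_base
  secondCountable_base := h.secondCountable_base

end LeftToRight

namespace IsRightPrincipal

variable {X P M : SmoothManifold.{u}} {S : LieGroupoid X} {μ : SmoothMap P X} {proj : SmoothMap P M}
  {act : P → S.Arr → P}

theorem mul_division (h : IsRightPrincipal S μ proj act) {p p' p'' : P} (hp : proj p = proj p')
    (hp' : proj p' = proj p'') :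
    S.mul (h.division p p') (h.division p' p'') = h.division p p'' := by
  have hcomp : S.src (h.division p p') = S.tgt (h.division p' p'') := by
    rw [h.src_division hp, h.tgt_division hp']
  refine (h.division_eq ?_ ?_).symm
  · rw [S.tgt_mul _ _ hcomp, h.tgt_division hp]
  · rw [h.act_mul _ _ _ (h.tgt_division hp).symm hcomp, h.act_division hp, h.act_division hp']

theorem D_tgt_D₂_division (h : IsRightPrincipal S μ proj act) {p p' : P} (hp : proj p = proj p')
    {v : Tan P p} {w : Tan P p'} (hvw : D proj p v = D proj p' w) :
    D S.tgt (h.division p p') (D₂ h.division {z | proj z.1 = proj z.2} p p' v w) = D μ p v := by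
  obtain ⟨γ, δ, hγ, hδ, hγδ⟩ :=
    h.submersion_proj.exists_hasVelocityAt_of_D_eq proj.contMDiff hp hvw
  have htgt := ((h.smooth_division.hasVelocityAt hp hγ hδ hγδ).comp (f := S.tgt)
    S.tgt.contMDiff.contMDiffAt).congr_point (h.tgt_division hp)
  refine htgt.unique ((hγ.comp (f := μ) μ.contMDiff.contMDiffAt).congr_of_eventuallyEq ?_)
  filter_upwards [hγδ] with τ hτ using h.tgt_division hτ

theorem D₂_act_D₂_division (h : IsRightPrincipal S μ proj act) {p p' : P} (hp : proj p = proj p')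
    {v : Tan P p} {w : Tan P p'} (hvw : D proj p v = D proj p' w) :
    D₂ act {z | μ z.1 = S.tgt z.2} p (h.division p p') v
      (D₂ h.division {z | proj z.1 = proj z.2} p p' v w) = w := by
  obtain ⟨γ, δ, hγ, hδ, hγδ⟩ :=
    h.submersion_proj.exists_hasVelocityAt_of_D_eq proj.contMDiff hp hvw
  have hact := (h.smooth_act.hasVelocityAt (h.tgt_division hp).symm hγ
    (h.smooth_division.hasVelocityAt hp hγ hδ hγδ)
    (hγδ.mono fun _ hτ => (h.tgt_division hτ).symm)).congr_point (h.act_division hp)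
  refine hact.unique (hδ.congr_of_eventuallyEq ?_)
  filter_upwards [hγδ] with τ hτ using h.act_division hτ

theorem exists_D₂_division_eq (h : IsRightPrincipal S μ proj act) {p p' : P}
    (hp : proj p = proj p') (a : Tan S.Arr (h.division p p')) :
    ∃ (v : Tan P p) (w : Tan P p'), D proj p v = D proj p' w ∧
      D₂ h.division {z | proj z.1 = proj z.2} p p' v w = a := by
  have hpg := (h.tgt_division hp).symm
  obtain ⟨v, hv⟩ := h.submersion_μ.surjective_D p (D S.tgt (h.division p p') a)
  obtain ⟨γ, β, hγ, hβ, hγβ⟩ :=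
    h.submersion_μ.exists_hasVelocityAt_of_D_eq S.tgt.contMDiff hpg hv
  have hδ := (h.smooth_act.hasVelocityAt hpg hγ hβ hγβ).congr_point (h.act_division hp)
  set w : Tan P p' := D₂ act {z | μ z.1 = S.tgt z.2} p (h.division p p') v a
  have hproj : ∀ᶠ τ in 𝓝 0, proj (act (γ τ) (β τ)) = proj (γ τ) :=
    hγβ.mono fun _ hτ => h.proj_act _ _ hτ
  refine ⟨v, w, ?_, ?_⟩
  · have hprojδ := hδ.comp (f := proj) proj.contMDiff.contMDiffAt
    exact ((hγ.comp (f := proj) proj.contMDiff.contMDiffAt).congr_point hp).unique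
      (hprojδ.congr_of_eventuallyEq (hproj.mono fun _ => Eq.symm))
  · refine (h.smooth_division.hasVelocityAt hp hγ hδ (hproj.mono fun _ => Eq.symm)).unique
      (hβ.congr_of_eventuallyEq ?_)
    filter_upwards [hγβ] with τ hτ using h.division_eq hτ rfl

end IsRightPrincipal

namespace PfaffianGroupoid

variable {X : SmoothManifold.{u}} (S : PfaffianGroupoid X)

theorem rep_congr {g g' : S.Arr} (hg : g = g') {x y : X} (hx : S.src g = x) (hy : S.tgt g = y)
    (hx' : S.src g' = x) (hy' : S.tgt g' = y) : S.rep g hx hy = S.rep g' hx' hy' := by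
  subst hg
  rfl

theorem rep_inv_rep (g : S.Arr) {x y : X} (hx : S.src g = x) (hy : S.tgt g = y)
    (hx' : S.src (S.inv g) = y) (hy' : S.tgt (S.inv g) = x) (e : S.E.Fib x) :
    S.rep (S.inv g) hx' hy' (S.rep g hx hy e) = e := by
  subst hx hx'
  have hmul := S.rep_mul (S.inv g) g (S.src_inv g) rfl hy' e
  rw [S.rep_congr (S.inv_mul g) _ _ (S.src_unit _) (S.tgt_unit _), S.rep_unit] at hmul
  exact hmul.symm

theorem rep_rep_inv (g : S.Arr) {x y : X} (hx : S.src g = x) (hy : S.tgt g = y)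
    (hx' : S.src (S.inv g) = y) (hy' : S.tgt (S.inv g) = x) (e : S.E.Fib y) :
    S.rep g hx hy (S.rep (S.inv g) hx' hy' e) = e := by
  have hinv := S.rep_inv_rep (S.inv g) hx' hy' (by rw [S.inv_inv, hx]) (by rw [S.inv_inv, hy]) e
  rwa [S.rep_congr (S.inv_inv g) _ _ hx hy] at hinv

end PfaffianGroupoid

/-- The identity isomorphism of a Pfaffian groupoid. -/
noncomputable def PfaffianIso.refl {X : SmoothManifold.{u}} (S : PfaffianGroupoid X) :
    PfaffianIso S S where
  φ := Diffeomorph.refl (𝓡 X.dim) X ∞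
  Φ := Diffeomorph.refl (𝓡 S.Arr.dim) S.Arr ∞
  src_Φ _ := rfl
  tgt_Φ _ := rfl
  Φ_mul _ _ _ := rfl
  Ψ _ _ hxy := Eq.rec (motive := fun y _ => S.E.Fib _ ≃ₗ[ℝ] S.E.Fib y) (LinearEquiv.refl ℝ _) hxy
  smooth_Ψ := contMDiff_id
  smooth_Ψ_symm := contMDiff_id
  Ψ_rep _ _ := rfl
  pullback_form g v := by
    have hD : D (Diffeomorph.refl (𝓡 S.Arr.dim) S.Arr ∞) g =
        ContinuousLinearMap.id ℝ (Tan S.Arr g) := mfderiv_id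
    rw [hD]
    rfl

namespace PrincipalPfaffianBibundle

variable {X₁ X₂ : SmoothManifold.{u}} {S₁ : PfaffianGroupoid X₁} {S₂ : PfaffianGroupoid X₂}
  (R : PrincipalPfaffianBibundle S₁ S₂)

theorem Φ_act₂ {p : R.P} {g : S₂.Arr} (hpg : R.μ₂ p = S₂.tgt g) {x : X₁} (hx : R.μ₁ p = x)
    (hx' : R.μ₁ (R.act₂ p g) = x) (hy : R.μ₂ (R.act₂ p g) = S₂.src g) (α : S₁.E.Fib x) :
    R.Φ (R.act₂ p g) hx' hy α =
      S₂.rep (S₂.inv g) (S₂.src_inv g) (S₂.tgt_inv g) (R.Φ p hx hpg α) := by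
  subst hx
  exact R.Φ_right p g hpg α

theorem rep_Φ_act₂ {p : R.P} {g : S₂.Arr} (hpg : R.μ₂ p = S₂.tgt g) {p' : R.P}
    (hact : R.act₂ p g = p') {x : X₁} (hx : R.μ₁ p = x) (hx' : R.μ₁ p' = x) {y y' : X₂}
    (hy : R.μ₂ p = y) (hy' : R.μ₂ p' = y') (hsrc : S₂.src g = y') (htgt : S₂.tgt g = y)
    (α : S₁.E.Fib x) : S₂.rep g hsrc htgt (R.Φ p' hx' hy' α) = R.Φ p hx hy α := by
  subst hact hsrc htgt
  rw [R.Φ_act₂ hpg hx, S₂.rep_rep_inv]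

theorem Φ_θ_congr {p : R.P} {x : X₁} (hx : R.μ₁ p = x) {y : X₂} (hy : R.μ₂ p = y)
    (v : Tan R.P p) : R.Φ p rfl hy (R.θ p rfl v) = R.Φ p hx hy (R.θ p hx v) := by
  subst hx
  rfl

theorem form_eq {p p' : R.P} {g : S₂.Arr} (hpg : R.μ₂ p = S₂.tgt g) (hact : R.act₂ p g = p')
    {x : X₁} (hx : R.μ₁ p = x) (hx' : R.μ₁ p' = x) {y : X₂} (hy : R.μ₂ p = y)
    (htgt : S₂.tgt g = y) {v : Tan R.P p} {w : Tan R.P p'} {a : Tan S₂.Arr g}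
    (ha : D R.μ₂ p v = D S₂.tgt g a) (hw : D₂ R.act₂ {z | R.μ₂ z.1 = S₂.tgt z.2} p g v a = w) :
    S₂.form g htgt a = R.Φ p hx hy (R.θ p' hx' w - R.θ p hx v) := by
  subst hact hw htgt
  have hmul := R.right.multiplicative p g hpg v a ha
  simp only [LinearMap.comp_apply, LinearEquiv.coe_coe] at hmul
  rw [R.Φ_θ_congr hx', R.Φ_θ_congr hx, R.Φ_act₂ hpg hx, ← map_add] at hmul
  have hrep := congrArg (S₂.rep g rfl rfl) hmul
  rw [S₂.rep_rep_inv, S₂.rep_rep_inv] at hrep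
  rw [map_sub, hrep, add_sub_cancel_left]

/-- The left principal bundle underlying a bibundle. -/
def toBundle : PrincipalPfaffianBundle S₁ X₂ where
  P := R.P
  μ := R.μ₁
  proj := R.μ₂
  act := R.act₁
  θ := R.θ
  isPfaffian := R.left

theorem division_eq_division_iff {p p' r r' : R.P} (hp : R.μ₁ p = R.μ₁ p')
    (hr : R.μ₁ r = R.μ₁ r') :
    R.right.principal.division p p' = R.right.principal.division r r' ↔
      ∃ g, S₁.src g = R.μ₁ p ∧ R.act₁ g p = r ∧ R.act₁ g p' = r' := by
  have hR := R.right.principal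
  have hL := R.left.principal
  have htgt := (hR.tgt_division hp).symm
  constructor
  · intro heq
    obtain ⟨g, hg, hgr⟩ := hL.transitive p r (by rw [htgt, heq, hR.tgt_division hr])
    refine ⟨g, hg, hgr, ?_⟩
    rw [← hR.act_division hp, ← R.commute g p _ hg htgt, hgr, heq, hR.act_division hr]
  · rintro ⟨g, hg, rfl, rfl⟩
    refine (hR.division_eq ((hL.proj_act g p hg).trans htgt) ?_).symm
    rw [R.commute g p _ hg htgt, hR.act_division hp]

/-- The structure groupoid on the right of a bibundle as the gauge groupoid of the underlying left
principal bundle: the class of `(p, p')` is the arrow taking `p` to `p'`. -/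
noncomputable def gauge : PfaffianGauge R.toBundle S₂ where
  q := R.right.principal.division
  smooth_q := R.right.principal.smooth_division
  submersion_q _ _ hp := R.right.principal.exists_D₂_division_eq hp
  surjective_q a := by
    obtain ⟨p, hp⟩ := R.right.principal.submersion_μ.1 (S₂.tgt a)
    exact ⟨p, R.act₂ p a, (R.right.principal.proj_act p a hp).symm,
      R.right.principal.division_eq hp rfl⟩
  q_eq_iff _ _ _ _ hp hr := R.division_eq_division_iff hp hr
  src_q _ _ hp := R.right.principal.src_division hp
  tgt_q _ _ hp := R.right.principal.tgt_division hp
  mul_q _ _ _ hp hp' := R.right.principal.mul_division hp hp'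
  j := R.Φ
  isBundleIso_j := R.isBundleIso
  j_act := R.Φ_left
  rep_q _ _ hp := R.rep_Φ_act₂ (R.right.principal.tgt_division hp).symm
    (R.right.principal.act_division hp) hp rfl rfl rfl _ _
  form_q _ _ hp _ _ hvw := R.form_eq (R.right.principal.tgt_division hp).symm
    (R.right.principal.act_division hp) hp rfl rfl _
    (R.right.principal.D_tgt_D₂_division hp hvw).symm
    (R.right.principal.D₂_act_D₂_division hp hvw)

end PrincipalPfaffianBibundle

section Pullback

variable {P X Y : SmoothManifold.{u}}

theorem contMDiff_pullback {E H A : Type*} [NormedAddCommGroup E] [NormedSpace ℝ E]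
    [TopologicalSpace H] {I : ModelWithCorners ℝ E H} [TopologicalSpace A] [ChartedSpace H A]
    {μ : SmoothMap P X} {F : VecBundle X} {f : A → TotalSpace F.Model ((μ : P → X) *ᵖ F.Fib)}
    (hbase : ContMDiff I (𝓡 P.dim) ∞ (fun a => (f a).1))
    (hlift : ContMDiff I ((𝓡 X.dim).prod 𝓘(ℝ, F.Model)) ∞
      (fun a => (⟨μ (f a).1, (f a).2⟩ : F.Tot))) :
    ContMDiff I ((𝓡 P.dim).prod 𝓘(ℝ, F.Model)) ∞ f := fun a =>
  contMDiffAt_totalSpace.2 ⟨hbase a, (contMDiffAt_totalSpace.1 (hlift a)).2⟩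

theorem contMDiff_pullback_lift (μ : SmoothMap P X) (F : VecBundle X) :
    ContMDiff ((𝓡 P.dim).prod 𝓘(ℝ, F.Model)) ((𝓡 X.dim).prod 𝓘(ℝ, F.Model)) ∞
      (fun z : TotalSpace F.Model ((μ : P → X) *ᵖ F.Fib) => (⟨μ z.1, z.2⟩ : F.Tot)) := fun z =>
  contMDiffAt_totalSpace.2 ⟨(μ.contMDiff.comp (contMDiff_proj _)) z,
    (contMDiffAt_totalSpace.1 (contMDiffAt_id (x := z))).2⟩

theorem SmoothForm.comp {μ : SmoothMap P X} {ν : SmoothMap P Y} {E : VecBundle X} {F : VecBundle Y}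
    {θ : PreForm μ E} (hθ : SmoothForm μ E θ) {f : FibreEquivs μ ν E F}
    (hf : SmoothFibreMaps μ ν E F (fun p => f p rfl rfl)) :
    SmoothForm ν F (fun p _ hy => (f p rfl hy).toLinearMap ∘ₗ θ p rfl) :=
  ContMDiff.comp hf (contMDiff_pullback
    (f := fun v : TangentBundle (𝓡 P.dim) P => ⟨v.1, θ v.1 rfl v.2⟩)
    (contMDiff_proj _) hθ)

end Pullback

namespace PfaffianGauge

variable {X M : SmoothManifold.{u}} {S : PfaffianGroupoid X} {B : PrincipalPfaffianBundle S M}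
  {G : PfaffianGroupoid M} (h : PfaffianGauge B G)

theorem q_act_act {p p' : B.P} (hp : B.μ p = B.μ p') {g : S.Arr} (hg : S.src g = B.μ p) :
    h.q (B.act g p) (B.act g p') = h.q p p' := by
  have hμ := B.isPfaffian.principal.μ_act
  exact ((h.q_eq_iff p p' _ _ hp (by rw [hμ g p hg, hμ g p' (hg.trans hp)])).2
    ⟨g, hg, rfl, rfl⟩).symm

theorem q_left_cancel {p p' p'' : B.P} (hp' : B.μ p = B.μ p') (hp'' : B.μ p = B.μ p'')
    (heq : h.q p p' = h.q p p'') : p' = p'' := by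
  obtain ⟨g, hg, hgp, hgp'⟩ := (h.q_eq_iff p p' p p'' hp' hp'').1 heq
  rw [← hgp', B.isPfaffian.principal.free g p hg hgp, hp', B.isPfaffian.principal.unit_act]

theorem q_self (p : B.P) : h.q p p = G.unit (B.proj p) := by
  have hcomp : G.src (h.q p p) = G.tgt (h.q p p) := by rw [h.src_q p p rfl, h.tgt_q p p rfl]
  rw [G.eq_unit_of_mul_self hcomp (h.mul_q p p p rfl rfl), h.tgt_q p p rfl]

theorem exists_q_eq {p : B.P} {a : G.Arr} (hpa : B.proj p = G.tgt a) :
    ∃ p', B.μ p = B.μ p' ∧ h.q p p' = a := by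
  obtain ⟨r, r', hr, rfl⟩ := h.surjective_q a
  obtain ⟨g, hg, rfl⟩ := B.isPfaffian.principal.transitive r p (by rw [hpa, h.tgt_q r r' hr])
  have hμ := B.isPfaffian.principal.μ_act
  exact ⟨B.act g r', by rw [hμ g r hg, hμ g r' (hg.trans hr)], h.q_act_act hr hg⟩

open scoped Classical in
/-- The right action of the gauge groupoid: `p · [p, p'] = p'`. On pairs that are not composable it
returns `p`. -/
noncomputable def act (p : B.P) (a : G.Arr) : B.P :=
  if hpa : B.proj p = G.tgt a then (h.exists_q_eq hpa).choose else p

theorem μ_act {p : B.P} {a : G.Arr} (hpa : B.proj p = G.tgt a) : B.μ p = B.μ (h.act p a) := by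
  rw [act, dif_pos hpa]
  exact (h.exists_q_eq hpa).choose_spec.1

theorem q_act {p : B.P} {a : G.Arr} (hpa : B.proj p = G.tgt a) : h.q p (h.act p a) = a := by
  rw [act, dif_pos hpa]
  exact (h.exists_q_eq hpa).choose_spec.2

theorem act_eq {p p' : B.P} {a : G.Arr} (hp : B.μ p = B.μ p') (hq : h.q p p' = a) :
    h.act p a = p' := by
  have hpa : B.proj p = G.tgt a := by rw [← hq, h.tgt_q p p' hp]
  exact h.q_left_cancel (h.μ_act hpa) hp ((h.q_act hpa).trans hq.symm)

theorem proj_act {p : B.P} {a : G.Arr} (hpa : B.proj p = G.tgt a) :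
    B.proj (h.act p a) = G.src a := by
  rw [← h.src_q _ _ (h.μ_act hpa), h.q_act hpa]

theorem act_q_eq_act_inv_division {r r' p : B.P} (hr : B.μ r = B.μ r') (hp : B.proj r = B.proj p) :
    h.act p (h.q r r') =
      B.act (S.inv (B.isPfaffian.principal.isRightPrincipal.division r p)) r' := by
  have hL := B.isPfaffian.principal
  have hdiv := hL.isRightPrincipal.act_division hp
  set g := hL.isRightPrincipal.division r p
  have hg : S.src (S.inv g) = B.μ r := by rw [S.src_inv, hL.isRightPrincipal.tgt_division hp]
  rw [← hdiv, ← h.q_act_act hr hg]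
  exact h.act_eq (by rw [hL.μ_act _ _ hg, hL.μ_act _ _ (hg.trans hr)]) rfl

/-- Near `(p, a)` the action is `(p, a) ↦ g⁻¹ r'`, where `(r, r')` depends on `a` through a local
section of `q`, and `g` is the division of `p` by `r` under the structure groupoid. -/
theorem smooth_act : SmoothOn₂ h.act {z | B.proj z.1 = G.tgt z.2} := by
  rintro ⟨p, a⟩ hpa
  set Z : Set (B.P × G.Arr) := {z | B.proj z.1 = G.tgt z.2}
  have hL := B.isPfaffian.principal.isRightPrincipal
  obtain ⟨k, hk, hkq⟩ := B.isPfaffian.principal.submersion_μ.exists_localSection_fibreProduct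
    B.μ.contMDiff (h.μ_act hpa) h.smooth_q (h.submersion_q _ _ (h.μ_act hpa))
  rw [h.q_act hpa] at hk hkq
  have hkZ : ContMDiffWithinAt ((𝓡 B.P.dim).prod (𝓡 G.Arr.dim))
      ((𝓡 B.P.dim).prod (𝓡 B.P.dim)) ∞ (fun z : B.P × G.Arr => k z.2) Z (p, a) :=
    (ContMDiffAt.comp (p, a) (g := k) hk contMDiffAt_snd).contMDiffWithinAt
  have hkqZ : ∀ᶠ z in 𝓝[Z] (p, a), B.μ (k z.2).1 = B.μ (k z.2).2 ∧
      h.q (k z.2).1 (k z.2).2 = z.2 ∧ B.proj (k z.2).1 = B.proj z.1 := by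
    filter_upwards [(continuousWithinAt_snd (p := (p, a))).eventually hkq, self_mem_nhdsWithin]
      with z ⟨hμ, hq⟩ (hz : B.proj z.1 = G.tgt z.2)
    exact ⟨hμ, hq, by rw [hz, ← hq, h.tgt_q _ _ hμ, hq]⟩
  have hdiv : ContMDiffWithinAt ((𝓡 B.P.dim).prod (𝓡 G.Arr.dim)) (𝓡 S.Arr.dim) ∞
      (fun z : B.P × G.Arr => hL.division (k z.2).1 z.1) Z (p, a) :=
    hL.smooth_division.contMDiffWithinAt_comp hkZ.fst contMDiffWithinAt_fst hpa
      (hkqZ.mono fun _ hz => hz.2.2)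
  refine (hL.smooth_act.contMDiffWithinAt_comp hkZ.snd hdiv hpa
    (hkqZ.mono fun _ hz => hz.1.symm.trans (hL.tgt_division hz.2.2).symm)
    ).congr_of_eventuallyEq_of_mem ?_ hpa
  filter_upwards [hkqZ] with z ⟨hμ, hq, hproj⟩
  rw [← h.act_q_eq_act_inv_division hμ hproj, hq]

/-- The homeomorphism `(p, a) ↦ (p, p · a)` from the domain of the action onto `P ×_X P`. -/
noncomputable def actHomeomorph :
    {z : B.P × G.Arr // B.proj z.1 = G.tgt z.2} ≃ₜ B.FibreSquare where
  toFun z := ⟨(z.1.1, h.act z.1.1 z.1.2), h.μ_act z.2⟩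
  invFun z := ⟨(z.1.1, h.q z.1.1 z.1.2), (h.tgt_q _ _ z.2).symm⟩
  left_inv z := Subtype.ext (Prod.ext rfl (h.q_act z.2))
  right_inv z := Subtype.ext (Prod.ext rfl (h.act_eq z.2 rfl))
  continuous_toFun := ((continuous_fst.comp continuous_subtype_val).prodMk
    (continuousOn_iff_continuous_domRestrict.1 h.smooth_act.continuousOn)).subtype_mk _
  continuous_invFun := ((continuous_fst.comp continuous_subtype_val).prodMk
    (continuousOn_iff_continuous_domRestrict.1 h.smooth_q.continuousOn)).subtype_mk _

theorem isRightPrincipal : IsRightPrincipal G.toLieGroupoid B.proj B.μ h.act where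
  smooth_act := h.smooth_act
  μ_act _ _ hpa := h.proj_act hpa
  act_mul p a b hpa hab := by
    have hpb : B.proj (h.act p a) = G.tgt b := (h.proj_act hpa).trans hab
    refine h.act_eq ((h.μ_act hpa).trans (h.μ_act hpb)) ?_
    rw [← h.mul_q _ _ _ (h.μ_act hpa) (h.μ_act hpb), h.q_act hpa, h.q_act hpb]
  act_unit p := h.act_eq rfl (h.q_self p)
  submersion_μ := B.isPfaffian.principal.submersion_proj
  submersion_proj := B.isPfaffian.principal.submersion_μ
  proj_act _ _ hpa := (h.μ_act hpa).symm
  transitive p p' hp := ⟨h.q p p', (h.tgt_q p p' hp).symm, h.act_eq hp rfl⟩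
  free p a hpa hact := by rw [← h.q_act hpa, hact, h.q_self]
  proper := by
    have := S.t2_base
    have hclosed : IsClosed B.FibreSquare :=
      isClosed_eq (B.μ.contMDiff.continuous.comp continuous_fst)
        (B.μ.contMDiff.continuous.comp continuous_snd)
    exact hclosed.isClosedEmbedding_subtypeVal.isProperMap.comp h.actHomeomorph.isProperMap
  t2_base := S.t2_base
  secondCountable_base := S.secondCountable_base

theorem D_μ_D₂_act {p : B.P} {a : G.Arr} (hpa : B.proj p = G.tgt a) {v : Tan B.P p}
    {w : Tan G.Arr a} (hvw : D B.proj p v = D G.tgt a w) :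
    D B.μ (h.act p a) (D₂ h.act {z | B.proj z.1 = G.tgt z.2} p a v w) = D B.μ p v := by
  obtain ⟨γ, β, hγ, hβ, hγβ⟩ := B.isPfaffian.principal.submersion_proj.exists_hasVelocityAt_of_D_eq
    G.tgt.contMDiff hpa hvw
  have hμ := (hγ.comp (f := B.μ) B.μ.contMDiff.contMDiffAt).congr_point (h.μ_act hpa)
  refine HasVelocityAt.unique ?_ hμ
  exact ((h.smooth_act.hasVelocityAt hpa hγ hβ hγβ).comp (f := B.μ)
    B.μ.contMDiff.contMDiffAt).congr_of_eventuallyEq (hγβ.mono fun _ hτ => h.μ_act hτ)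

theorem D₂_q_D₂_act {p : B.P} {a : G.Arr} (hpa : B.proj p = G.tgt a) {v : Tan B.P p}
    {w : Tan G.Arr a} (hvw : D B.proj p v = D G.tgt a w) :
    D₂ h.q B.FibreSquare p (h.act p a) v (D₂ h.act {z | B.proj z.1 = G.tgt z.2} p a v w) = w := by
  obtain ⟨γ, β, hγ, hβ, hγβ⟩ := B.isPfaffian.principal.submersion_proj.exists_hasVelocityAt_of_D_eq
    G.tgt.contMDiff hpa hvw
  have hq := h.smooth_q.hasVelocityAt (h.μ_act hpa) hγ (h.smooth_act.hasVelocityAt hpa hγ hβ hγβ)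
    (hγβ.mono fun _ hτ => h.μ_act hτ)
  exact (hq.congr_point (h.q_act hpa)).unique
    (hβ.congr_of_eventuallyEq (hγβ.mono fun _ hτ => h.q_act hτ))

theorem rep_j {p p' : B.P} (hp : B.μ p = B.μ p') {a : G.Arr} (ha : h.q p p' = a) {x : X}
    (hx : B.μ p = x) (hx' : B.μ p' = x) {y y' : M} (hy : B.proj p = y) (hy' : B.proj p' = y')
    (hsrc : G.src a = y') (htgt : G.tgt a = y) (α : S.E.Fib x) :
    G.rep a hsrc htgt (h.j p' hx' hy' α) = h.j p hx hy α := by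
  subst hx' ha hy' hy
  exact h.rep_q p p' hp α

theorem j_θ_congr {p : B.P} {x : X} (hx : B.μ p = x) (v : Tan B.P p) :
    h.j p rfl rfl (B.θ p rfl v) = h.j p hx rfl (B.θ p hx v) := by
  subst hx
  rfl

theorem form_eq {p p' : B.P} (hp : B.μ p = B.μ p') {a : G.Arr} (ha : h.q p p' = a) {y : M}
    (hy : B.proj p = y) (htgt : G.tgt a = y) {v : Tan B.P p} {w : Tan B.P p'} {b : Tan G.Arr a}
    (hvw : D B.μ p v = D B.μ p' w) (hb : D₂ h.q B.FibreSquare p p' v w = b) :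
    G.form a htgt b = h.j p hp hy (B.θ p' rfl w) - h.j p rfl hy (B.θ p rfl v) := by
  subst ha hb hy
  rw [h.j_θ_congr hp, ← map_sub]
  exact h.form_q p p' hp v w hvw

theorem isRightPfaffian : IsRightPfaffian G B.proj B.μ h.act
    (fun p _ hy => (h.j p rfl hy).toLinearMap ∘ₗ B.θ p rfl) where
  principal := h.isRightPrincipal
  smooth_θ := B.isPfaffian.smooth_θ.comp h.isBundleIso_j.1
  multiplicative p a hpa v w hvw := by
    have hform := h.form_eq (h.μ_act hpa) (h.q_act hpa) hpa rfl (h.D_μ_D₂_act hpa hvw).symm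
      (h.D₂_q_D₂_act hpa hvw)
    have hrep := h.rep_j (h.μ_act hpa) (h.q_act hpa) (h.μ_act hpa) rfl hpa (h.proj_act hpa) rfl rfl
      (B.θ (h.act p a) rfl (D₂ h.act {z | B.proj z.1 = G.tgt z.2} p a v w))
    rw [← map_add, hform]
    simp only [LinearMap.comp_apply, LinearEquiv.coe_coe, add_sub_cancel]
    rw [← hrep, G.rep_inv_rep]
  ker_eq p := by
    rw [LinearEquiv.ker_comp (h.j p rfl rfl)]
    exact (B.isPfaffian.ker_eq p).symm

/-- A principal bundle as a bibundle between its structure groupoid and its gauge groupoid. -/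
noncomputable def toBibundle : PrincipalPfaffianBibundle S G where
  P := B.P
  μ₁ := B.μ
  μ₂ := B.proj
  act₁ := B.act
  act₂ := h.act
  θ := B.θ
  Φ := h.j
  isBundleIso := h.isBundleIso_j
  left := B.isPfaffian
  right := h.isRightPfaffian
  commute g p a hg hpa := by
    have hL := B.isPfaffian.principal
    refine h.act_eq ?_ ?_
    · rw [hL.μ_act _ _ hg, hL.μ_act _ _ (hg.trans (h.μ_act hpa))]
    · rw [h.q_act_act (h.μ_act hpa) hg, h.q_act hpa]
  Φ_left := h.j_act
  Φ_right p a hpa α := by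
    rw [← h.rep_j (h.μ_act hpa) (h.q_act hpa) rfl (h.μ_act hpa).symm hpa (h.proj_act hpa) rfl rfl,
      G.rep_inv_rep]

end PfaffianGauge

section Diffeo

variable {M N L : SmoothManifold.{u}}

/-- The chart `ε ∘ e ∘ φ⁻¹` obtained by pushing a chart `e` forward along a diffeomorphism `φ`. The
linear isomorphism `ε` identifies the model spaces, whose dimensions agree only propositionally. -/
noncomputable def Diffeo.pushforwardChart (φ : Diffeo N L)
    (ε : EuclideanSpace ℝ (Fin N.dim) ≃L[ℝ] EuclideanSpace ℝ (Fin L.dim))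
    (e : OpenPartialHomeomorph N (EuclideanSpace ℝ (Fin N.dim))) :
    OpenPartialHomeomorph L (EuclideanSpace ℝ (Fin L.dim)) :=
  (φ.symm.toHomeomorph.toOpenPartialHomeomorph ≫ₕ e) ≫ₕ ε.toHomeomorph.toOpenPartialHomeomorph

theorem Diffeo.mem_source_pushforwardChart (φ : Diffeo N L)
    (ε : EuclideanSpace ℝ (Fin N.dim) ≃L[ℝ] EuclideanSpace ℝ (Fin L.dim))
    {e : OpenPartialHomeomorph N (EuclideanSpace ℝ (Fin N.dim))} {y : L} :
    y ∈ (φ.pushforwardChart ε e).source ↔ φ.symm y ∈ e.source := by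
  simp [pushforwardChart]

theorem Diffeo.mem_target_pushforwardChart (φ : Diffeo N L)
    (ε : EuclideanSpace ℝ (Fin N.dim) ≃L[ℝ] EuclideanSpace ℝ (Fin L.dim))
    {e : OpenPartialHomeomorph N (EuclideanSpace ℝ (Fin N.dim))}
    {y : EuclideanSpace ℝ (Fin L.dim)} :
    y ∈ (φ.pushforwardChart ε e).target ↔ ε.symm y ∈ e.target := by
  simp [pushforwardChart]

theorem Diffeo.pushforwardChart_mem_maximalAtlas (φ : Diffeo N L)
    (ε : EuclideanSpace ℝ (Fin N.dim) ≃L[ℝ] EuclideanSpace ℝ (Fin L.dim))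
    {e : OpenPartialHomeomorph N (EuclideanSpace ℝ (Fin N.dim))}
    (he : e ∈ IsManifold.maximalAtlas (𝓡 N.dim) ∞ N) :
    φ.pushforwardChart ε e ∈ IsManifold.maximalAtlas (𝓡 L.dim) ∞ L := by
  refine OpenPartialHomeomorph.mem_maximalAtlas_of_contMDiffOn (I := 𝓡 L.dim) (n := ∞) (M := L)
    _ ?_ ?_
  · exact ε.contDiff.contMDiff.comp_contMDiffOn ((contMDiffOn_of_mem_maximalAtlas he).comp
      φ.symm.contMDiff.contMDiffOn fun _ hy => (φ.mem_source_pushforwardChart ε).1 hy)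
  · exact φ.contMDiff.comp_contMDiffOn ((contMDiffOn_symm_of_mem_maximalAtlas he).comp
      ε.symm.contDiff.contMDiff.contMDiffOn fun _ hy => (φ.mem_target_pushforwardChart ε).1 hy)

theorem IsSurjSubmersion.diffeo_comp {f : M → N} (hf : IsSurjSubmersion f) (φ : Diffeo N L) :
    IsSurjSubmersion (φ ∘ f) := by
  obtain ⟨hsurj, F, _, _, hF⟩ := hf
  refine ⟨φ.surjective.comp hsurj, F, inferInstance, inferInstance, fun x => ?_⟩
  let ε : EuclideanSpace ℝ (Fin N.dim) ≃L[ℝ] EuclideanSpace ℝ (Fin L.dim) :=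
    φ.mfderivToContinuousLinearEquiv (by simp) (f x)
  refine Manifold.IsSubmersionAtOfComplement.mk_of_charts
    ((hF x).equiv.trans (ε.prodCongr (ContinuousLinearEquiv.refl ℝ F))) (hF x).domChart
    (φ.pushforwardChart ε (hF x).codChart) (hF x).mem_domChart_source ?_
    (hF x).domChart_mem_maximalAtlas
    (φ.pushforwardChart_mem_maximalAtlas ε (hF x).codChart_mem_maximalAtlas)
    (fun y hy => ?_) fun y hy => ?_
  · simpa [φ.mem_source_pushforwardChart] using (hF x).mem_codChart_source
  · simpa [φ.mem_source_pushforwardChart] using (hF x).source_subset_preimage_source hy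
  · have hwritten := congrArg ε ((hF x).writtenInCharts hy)
    simpa [Diffeo.pushforwardChart] using hwritten

end Diffeo

namespace PfaffianIso

variable {X₁ X₂ : SmoothManifold.{u}} {S₁ : PfaffianGroupoid X₁} {S₂ : PfaffianGroupoid X₂}
  (I : PfaffianIso S₁ S₂)

theorem φ_src_symm (g : S₂.Arr) : I.φ (S₁.src (I.Φ.symm g)) = S₂.src g := by
  rw [← I.src_Φ, I.Φ.apply_symm_apply]

theorem φ_tgt_symm (g : S₂.Arr) : I.φ (S₁.tgt (I.Φ.symm g)) = S₂.tgt g := by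
  rw [← I.tgt_Φ, I.Φ.apply_symm_apply]

theorem src_symm_eq_tgt_symm {g k : S₂.Arr} (hgk : S₂.src g = S₂.tgt k) :
    S₁.src (I.Φ.symm g) = S₁.tgt (I.Φ.symm k) :=
  I.φ.injective ((I.φ_src_symm g).trans (hgk.trans (I.φ_tgt_symm k).symm))

theorem Φ_unit (x : X₁) : I.Φ (S₁.unit x) = S₂.unit (I.φ x) := by
  have hcomp : S₁.src (S₁.unit x) = S₁.tgt (S₁.unit x) := by rw [S₁.src_unit, S₁.tgt_unit]
  have hidem : S₁.mul (S₁.unit x) (S₁.unit x) = S₁.unit x := by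
    simpa only [S₁.src_unit] using S₁.mul_unit (S₁.unit x)
  rw [S₂.eq_unit_of_mul_self (g := I.Φ (S₁.unit x)) (by rw [I.src_Φ, I.tgt_Φ, hcomp])
    (by rw [← I.Φ_mul _ _ hcomp, hidem]), I.tgt_Φ, S₁.tgt_unit]

theorem Φ_inv (g : S₁.Arr) : I.Φ (S₁.inv g) = S₂.inv (I.Φ g) := by
  have hcomp : S₁.src g = S₁.tgt (S₁.inv g) := (S₁.tgt_inv g).symm
  refine S₂.eq_inv_of_mul_eq_unit (by rw [I.src_Φ, I.tgt_Φ, hcomp]) ?_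
  rw [← I.Φ_mul _ _ hcomp, S₁.mul_inv, I.Φ_unit, I.tgt_Φ]

theorem Φ_inv_symm (g : S₂.Arr) : I.Φ (S₁.inv (I.Φ.symm g)) = S₂.inv g := by
  rw [I.Φ_inv, I.Φ.apply_symm_apply]

theorem Φ_symm_mul {g k : S₂.Arr} (hgk : S₂.src g = S₂.tgt k) :
    I.Φ.symm (S₂.mul g k) = S₁.mul (I.Φ.symm g) (I.Φ.symm k) := by
  refine I.Φ.injective (?_ : I.Φ _ = I.Φ _)
  rw [I.Φ_mul _ _ (I.src_symm_eq_tgt_symm hgk), I.Φ.apply_symm_apply, I.Φ.apply_symm_apply,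
    I.Φ.apply_symm_apply]

theorem Φ_symm_unit (x : X₁) : I.Φ.symm (S₂.unit (I.φ x)) = S₁.unit x := by
  rw [← I.Φ_unit, I.Φ.symm_apply_apply]

theorem Ψ_rep_of_eq {a : S₁.Arr} {b : S₂.Arr} (hab : I.Φ a = b) {x y : X₁} {x' y' : X₂}
    (hx : S₁.src a = x) (hy : S₁.tgt a = y) (hx' : S₂.src b = x') (hy' : S₂.tgt b = y')
    (hφ : I.φ x = x') (hφ' : I.φ y = y') (α : S₁.E.Fib x) :
    I.Ψ hφ' (S₁.rep a hx hy α) = S₂.rep b hx' hy' (I.Ψ hφ α) := by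
  subst hab hx hy hφ hφ'
  exact I.Ψ_rep a α

theorem form_eq {a : S₁.Arr} {b : S₂.Arr} (hab : I.Φ a = b) {y : X₁} {y' : X₂}
    (hy : S₁.tgt a = y) (hy' : S₂.tgt b = y') (hφ : I.φ y = y') {v : Tan S₁.Arr a}
    {w : Tan S₂.Arr b} (hw : D I.Φ a v = w) : S₂.form b hy' w = I.Ψ hφ (S₁.form a hy v) := by
  subst hab hw hy hφ
  exact I.pullback_form a v

theorem D_Φ_D_symm (g : S₂.Arr) (w : Tan S₂.Arr g) :
    D I.Φ (I.Φ.symm g) (D I.Φ.symm g w) = w := by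
  obtain ⟨β, hβ⟩ := exists_hasVelocityAt (I := 𝓡 S₂.Arr.dim) g w
  have hΦ := ((hβ.comp (f := I.Φ.symm) I.Φ.symm.contMDiff.contMDiffAt).comp (f := I.Φ)
    I.Φ.contMDiff.contMDiffAt).congr_point (I.Φ.apply_symm_apply g)
  exact hΦ.unique (hβ.congr_of_eventuallyEq
    (Eventually.of_forall fun τ => I.Φ.apply_symm_apply (β τ)))

theorem mk_Ψ_symm {x : X₁} {y : X₂} (hxy : I.φ x = y) (α : S₂.E.Fib y) :
    (⟨I.φ.symm y, (I.Ψ (I.φ.apply_symm_apply y)).symm α⟩ : S₁.E.Tot) =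
      ⟨x, (I.Ψ hxy).symm α⟩ := by
  have hcongr : ∀ (x' : X₁) (hx'y : I.φ x' = y), x' = x →
      (⟨x', (I.Ψ hx'y).symm α⟩ : S₁.E.Tot) = ⟨x, (I.Ψ hxy).symm α⟩ := by
    rintro x' hx'y rfl
    rfl
  exact hcongr _ _ (by rw [← hxy, I.φ.symm_apply_apply])

end PfaffianIso

namespace PrincipalPfaffianBibundle

variable {X₁ X X₂ : SmoothManifold.{u}} {S₁ : PfaffianGroupoid X₁} {G : PfaffianGroupoid X}
  {S₂ : PfaffianGroupoid X₂} (R : PrincipalPfaffianBibundle S₁ G) (I : PfaffianIso G S₂)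

/-- The right moment map after transport along an isomorphism. -/
noncomputable def transMoment : SmoothMap R.P X₂ := ⟨I.φ ∘ R.μ₂, I.φ.contMDiff.comp R.μ₂.contMDiff⟩

/-- The right action after transport along an isomorphism. -/
noncomputable def transAct (p : R.P) (g : S₂.Arr) : R.P := R.act₂ p (I.Φ.symm g)

/-- The bundle isomorphism after transport along an isomorphism. -/
noncomputable def transFibreEquivs : FibreEquivs R.μ₁ (R.transMoment I) S₁.E S₂.E :=
  fun p _ _ hx hy => (R.Φ p hx rfl).trans (I.Ψ hy)

theorem transFibreEquivs_apply {p : R.P} {x : X₁} {y : X} {z : X₂} (hx : R.μ₁ p = x)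
    (hy : R.μ₂ p = y) (hφ : I.φ y = z) (hz : R.transMoment I p = z) (α : S₁.E.Fib x) :
    R.transFibreEquivs I p hx hz α = I.Ψ hφ (R.Φ p hx hy α) := by
  subst hy
  rfl

theorem transMoment_eq_tgt_iff {p : R.P} {g : S₂.Arr} :
    R.transMoment I p = S₂.tgt g ↔ R.μ₂ p = G.tgt (I.Φ.symm g) := by
  rw [← I.φ_tgt_symm g]
  exact I.φ.injective.eq_iff

theorem isBundleIso_transFibreEquivs :
    IsBundleIso R.μ₁ (R.transMoment I) S₁.E S₂.E (R.transFibreEquivs I) := by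
  refine ⟨I.smooth_Ψ.comp R.isBundleIso.1, ?_⟩
  refine R.isBundleIso.2.comp (contMDiff_pullback (μ := R.μ₂) (F := G.E)
    (f := fun z : TotalSpace S₂.E.Model ((R.transMoment I : R.P → X₂) *ᵖ S₂.E.Fib) =>
      (⟨z.1, (I.Ψ rfl).symm z.2⟩ : TotalSpace G.E.Model ((R.μ₂ : R.P → X) *ᵖ G.E.Fib)))
    (contMDiff_proj _) ?_)
  exact (I.smooth_Ψ_symm.comp (contMDiff_pullback_lift (R.transMoment I) S₂.E)).congr fun z =>
    (I.mk_Ψ_symm rfl _).symm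

theorem ker_D_transMoment (p : R.P) : (D (R.transMoment I) p).ker = (D R.μ₂ p).ker := by
  have hcomp : D (R.transMoment I) p = (D I.φ (R.μ₂ p)).comp (D R.μ₂ p) :=
    mfderiv_comp p (I.φ.contMDiff.mdifferentiable (by simp) _)
      (R.μ₂.contMDiff.mdifferentiable (by simp) _)
  have hinj : Function.Injective (D I.φ (R.μ₂ p)) :=
    (I.φ.mfderivToContinuousLinearEquiv (by simp) (R.μ₂ p)).injective
  ext v
  rw [hcomp, LinearMap.mem_ker, LinearMap.mem_ker]
  exact map_eq_zero_iff _ hinj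

theorem isLeftPfaffian_trans : IsLeftPfaffian S₁ R.μ₁ (R.transMoment I) R.act₁ R.θ where
  principal :=
    { R.left.principal with
      submersion_proj := R.left.principal.submersion_proj.diffeo_comp I.φ
      proj_act := fun g p hg => congrArg I.φ (R.left.principal.proj_act g p hg)
      transitive := fun p p' hp => R.left.principal.transitive p p' (I.φ.injective hp)
      t2_base := S₂.t2_base
      secondCountable_base := S₂.secondCountable_base }
  smooth_θ := R.left.smooth_θ
  multiplicative := R.left.multiplicative
  ker_eq p := by
    rw [R.ker_D_transMoment I]
    exact R.left.ker_eq p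

/-- The homeomorphism `(p, g) ↦ (p, Φ⁻¹ g)` from the domain of the transported action onto that of
the original one. -/
noncomputable def transHomeomorph :
    {z : R.P × S₂.Arr // R.transMoment I z.1 = S₂.tgt z.2} ≃ₜ
      {z : R.P × G.Arr // R.μ₂ z.1 = G.tgt z.2} :=
  ((Homeomorph.refl R.P).prodCongr I.Φ.symm.toHomeomorph).subtype fun _ =>
    R.transMoment_eq_tgt_iff I

theorem isRightPrincipal_trans :
    IsRightPrincipal S₂.toLieGroupoid (R.transMoment I) R.μ₁ (R.transAct I) where
  smooth_act :=
    ContMDiffOn.comp (t := {z : R.P × G.Arr | R.μ₂ z.1 = G.tgt z.2})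
      (f := fun z : R.P × S₂.Arr => (z.1, I.Φ.symm z.2)) R.right.principal.smooth_act
      (contMDiff_fst.prodMk (I.Φ.symm.contMDiff.comp contMDiff_snd)).contMDiffOn
      fun _ hz => (R.transMoment_eq_tgt_iff I).1 hz
  μ_act p g hpg := by
    refine Eq.trans (congrArg I.φ ?_) (I.φ_src_symm g)
    exact R.right.principal.μ_act p _ ((R.transMoment_eq_tgt_iff I).1 hpg)
  act_mul p g k hpg hgk := by
    rw [transAct, I.Φ_symm_mul hgk, R.right.principal.act_mul _ _ _
      ((R.transMoment_eq_tgt_iff I).1 hpg) (I.src_symm_eq_tgt_symm hgk)]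
    rfl
  act_unit p := (congrArg (R.act₂ p) (I.Φ_symm_unit _)).trans (R.right.principal.act_unit p)
  submersion_μ := R.right.principal.submersion_μ.diffeo_comp I.φ
  submersion_proj := R.right.principal.submersion_proj
  proj_act p g hpg := R.right.principal.proj_act p _ ((R.transMoment_eq_tgt_iff I).1 hpg)
  transitive p p' hp := by
    obtain ⟨g, hpg, hact⟩ := R.right.principal.transitive p p' hp
    refine ⟨I.Φ g, ?_, by rw [transAct, I.Φ.symm_apply_apply, hact]⟩
    rw [R.transMoment_eq_tgt_iff, I.Φ.symm_apply_apply, hpg]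
  free p g hpg hact := by
    rw [← I.Φ.apply_symm_apply g,
      R.right.principal.free p _ ((R.transMoment_eq_tgt_iff I).1 hpg) hact, I.Φ_unit]
    rfl
  proper := R.right.principal.proper.comp (R.transHomeomorph I).isProperMap
  t2_base := S₁.t2_base
  secondCountable_base := S₁.secondCountable_base

section Tangent

variable {p : R.P} {g : S₂.Arr} (hpg : R.transMoment I p = S₂.tgt g) {v : Tan R.P p}
  {w : Tan S₂.Arr g} (hvw : D (R.transMoment I) p v = D S₂.tgt g w)
include hpg hvw

theorem D_tgt_D_Φ_symm : D R.μ₂ p v = D G.tgt (I.Φ.symm g) (D I.Φ.symm g w) := by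
  obtain ⟨γ, β, hγ, hβ, hγβ⟩ :=
    (R.isRightPrincipal_trans I).submersion_μ.exists_hasVelocityAt_of_D_eq S₂.tgt.contMDiff hpg hvw
  have hμ := (hγ.comp (f := R.μ₂) R.μ₂.contMDiff.contMDiffAt).congr_point
    ((R.transMoment_eq_tgt_iff I).1 hpg)
  exact hμ.unique (((hβ.comp (f := I.Φ.symm) I.Φ.symm.contMDiff.contMDiffAt).comp (f := G.tgt)
    G.tgt.contMDiff.contMDiffAt).congr_of_eventuallyEq
      (hγβ.mono fun _ hτ => (R.transMoment_eq_tgt_iff I).1 hτ))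

theorem D₂_transAct :
    D₂ (R.transAct I) {z | R.transMoment I z.1 = S₂.tgt z.2} p g v w =
      D₂ R.act₂ {z | R.μ₂ z.1 = G.tgt z.2} p (I.Φ.symm g) v (D I.Φ.symm g w) := by
  obtain ⟨γ, β, hγ, hβ, hγβ⟩ :=
    (R.isRightPrincipal_trans I).submersion_μ.exists_hasVelocityAt_of_D_eq S₂.tgt.contMDiff hpg hvw
  exact ((R.isRightPrincipal_trans I).smooth_act.hasVelocityAt hpg hγ hβ hγβ).unique
    (R.right.principal.smooth_act.hasVelocityAt ((R.transMoment_eq_tgt_iff I).1 hpg) hγ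
      (hβ.comp (f := I.Φ.symm) I.Φ.symm.contMDiff.contMDiffAt)
      (hγβ.mono fun _ hτ => (R.transMoment_eq_tgt_iff I).1 hτ))

end Tangent

theorem isRightPfaffian_trans : IsRightPfaffian S₂ (R.transMoment I) R.μ₁ (R.transAct I)
    (fun p _ hy => (R.transFibreEquivs I p rfl hy).toLinearMap ∘ₗ R.θ p rfl) where
  principal := R.isRightPrincipal_trans I
  smooth_θ := R.left.smooth_θ.comp (R.isBundleIso_transFibreEquivs I).1
  multiplicative p g hpg v w hvw := by
    have hpg' := (R.transMoment_eq_tgt_iff I).1 hpg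
    have hμ := R.right.principal.μ_act p _ hpg'
    have hmul := congrArg (I.Ψ (I.φ_src_symm g)) (R.right.multiplicative p (I.Φ.symm g) hpg' v _
      (R.D_tgt_D_Φ_symm I hpg hvw))
    have hrep := I.Ψ_rep_of_eq (I.Φ_inv_symm g) (G.src_inv _) (G.tgt_inv _) (S₂.src_inv g)
      (S₂.tgt_inv g) (I.φ_tgt_symm g) (I.φ_src_symm g)
    rw [map_add, hrep, hrep,
      ← I.form_eq (I.Φ.apply_symm_apply g) rfl rfl _ (I.D_Φ_D_symm g w)] at hmul
    simp only [LinearMap.comp_apply, LinearEquiv.coe_coe] at hmul ⊢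
    rw [R.transFibreEquivs_apply I rfl hpg' (I.φ_tgt_symm g), ← hmul, R.D₂_transAct I hpg hvw]
    exact R.transFibreEquivs_apply I rfl hμ (I.φ_src_symm g) _ _
  ker_eq p := by
    rw [LinearEquiv.ker_comp (R.transFibreEquivs I p rfl rfl), R.ker_D_transMoment I]
    exact (R.left.ker_eq p).symm

/-- Transport of a bibundle along an isomorphism of the groupoid acting on the right. -/
noncomputable def trans : PrincipalPfaffianBibundle S₁ S₂ where
  P := R.P
  μ₁ := R.μ₁
  μ₂ := R.transMoment I
  act₁ := R.act₁
  act₂ := R.transAct I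
  θ := R.θ
  Φ := R.transFibreEquivs I
  isBundleIso := R.isBundleIso_transFibreEquivs I
  left := R.isLeftPfaffian_trans I
  right := R.isRightPfaffian_trans I
  commute g p k hg hpk := R.commute g p _ hg ((R.transMoment_eq_tgt_iff I).1 hpk)
  Φ_left g p hg α :=
    (R.transFibreEquivs_apply I _ (R.left.principal.proj_act g p hg) rfl _ _).trans
      (congrArg (I.Ψ rfl) (R.Φ_left g p hg α))
  Φ_right p g hpg α := by
    have hpg' := (R.transMoment_eq_tgt_iff I).1 hpg
    refine (R.transFibreEquivs_apply I _ (R.right.principal.μ_act p _ hpg') (I.φ_src_symm g) _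
      _).trans ?_
    rw [R.transFibreEquivs_apply I rfl hpg' (I.φ_tgt_symm g), R.Φ_right p _ hpg',
      I.Ψ_rep_of_eq (I.Φ_inv_symm g) _ _ (S₂.src_inv g) (S₂.tgt_inv g) (I.φ_tgt_symm g)]

end PrincipalPfaffianBibundle

end Pfaffian

theorem mainTheorem1 {X₁ X₂ : Pfaffian.SmoothManifold.{u}}
    (S₁ : Pfaffian.PfaffianGroupoid X₁) (S₂ : Pfaffian.PfaffianGroupoid X₂) :
    Pfaffian.PfaffianMoritaEquivalent S₁ S₂ ↔
      ∃ (M : Pfaffian.SmoothManifold.{u}) (B : Pfaffian.PrincipalPfaffianBundle S₁ M)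
        (G : Pfaffian.PfaffianGroupoid M),
        Nonempty (Pfaffian.PfaffianGauge B G) ∧ Nonempty (Pfaffian.PfaffianIso G S₂) := by
  constructor
  · rintro ⟨R⟩
    exact ⟨X₂, R.toBundle, S₂, ⟨R.gauge⟩, ⟨Pfaffian.PfaffianIso.refl S₂⟩⟩
  · rintro ⟨M, B, G, ⟨h⟩, ⟨I⟩⟩
    exact ⟨h.toBibundle.trans I⟩
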